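/- Let $G\subseteq \mathrm{GL}_n(\mathbb C)$ be a reductive complex linear algebraic group (not necessarily connected), given with its faithful representation on $\mathbb C^n$, let $\mathfrak g\subseteq\mathfrak{gl}_n(\mathbb C)$ be its Lie algebra, and put $(\xi,\eta)=\operatorname{tr}(\xi\eta)$ for $\xi,\eta\in\mathfrak g$. Let $h\in[\mathfrak g,\mathfrak g]$, $h\neq 0$, define a $\mathbb Z$-grading of $\mathfrak g$, i.e. $\mathfrak g=\bigoplus_{s\in\mathbb Z}\mathfrak g_s$ with $\mathfrak g_s=\{\xi\in\mathfrak g : [h,\xi]=s\xi\}$. Let $\tilde{\mathfrak g}_0=\{\xi\in\mathfrak g_0 : (h,\xi)=0\}$ be the orthogonal complement of $h$ in $\mathfrak g_0$, and let $G_0$ and $\tilde G_0$ (the reduced $\theta$-group) be the connected subgroups of $G$ with Lie algebras $\mathfrak g_0$ and $\tilde{\mathfrak g}_0$, i.e. the subgroups generated by $\exp(\mathfrak g_0)$ and $\exp(\tilde{\mathfrak g}_0)$; they act on $\mathfrak g_1$ by the adjoint action $g\cdot x=gxg^{-1}$. An element $c\in\mathfrak g_0$ is called a Dynkin characteristic of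 $x\in\mathfrak g_1$ if there is $y\in\mathfrak g_{-1}$ with $[x,y]=c$, $[c,x]=2x$ and $[c,y]=-2y$. Then for every $x\in\mathfrak g_1$ we have $\tilde G_0x\neq G_0x$ if and only if $2h$ is a Dynkin characteristic of $x$. -/

import Mathlib

attribute [local instance 100] LieRing.ofAssociativeRing

/-! ### Auxiliary analysis: the Lie product formula -/

namespace ThetaGroup

set_option linter.unusedSectionVars false

open Filter Topology

section Trotter

variable {A : Type*} [NormedRing A] [NormedAlgebra ℂ A] [NormOneClass A] [CompleteSpace A]

theorem norm_pow_sub_pow_le (a b : A) {M : ℝ} (hM : 1 ≤ M) (ha : ‖a‖ ≤ M) (hb : ‖b‖ ≤ M)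
    (k : ℕ) : ‖a ^ k - b ^ k‖ ≤ k * M ^ k * ‖a - b‖ := by
  induction k with
  | zero => simp
  | succ k ih =>
    have h0 : (0 : ℝ) ≤ M := by linarith
    have e : a ^ (k + 1) - b ^ (k + 1) = a ^ k * (a - b) + (a ^ k - b ^ k) * b := by
      rw [pow_succ, pow_succ]; noncomm_ring
    have h1 : ‖a ^ k * (a - b)‖ ≤ M ^ (k + 1) * ‖a - b‖ := by
      refine (norm_mul_le _ _).trans ?_
      refine mul_le_mul_of_nonneg_right ?_ (norm_nonneg _)
      calc ‖a ^ k‖ ≤ ‖a‖ ^ k := norm_pow_le _ _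
        _ ≤ M ^ k := by gcongr
        _ ≤ M ^ (k + 1) := pow_le_pow_right₀ hM (Nat.le_succ k)
    have h2 : ‖(a ^ k - b ^ k) * b‖ ≤ (k * M ^ k * ‖a - b‖) * M :=
      (norm_mul_le _ _).trans (by gcongr)
    rw [e]
    refine (norm_add_le _ _).trans ((add_le_add h1 h2).trans (le_of_eq ?_))
    push_cast
    ring

theorem tendsto_pow_sub_pow {a b : ℕ → A} {Z : A}
    (ha : Tendsto (fun k : ℕ => (k : ℂ) • (a k - 1)) atTop (𝓝 Z))
    (hb : Tendsto (fun k : ℕ => (k : ℂ) • (b k - 1)) atTop (𝓝 Z)) :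
    Tendsto (fun k : ℕ => a k ^ k - b k ^ k) atTop (𝓝 0) := by
  set C : ℝ := ‖Z‖ + 1 with hC
  have hC0 : 0 ≤ C := by positivity
  have key : ∀ c : ℕ → A, Tendsto (fun k : ℕ => (k : ℂ) • (c k - 1)) atTop (𝓝 Z) →
      ∀ᶠ k : ℕ in atTop, ‖c k‖ ≤ Real.exp (C / k) := by
    intro c hc
    have h1 : ∀ᶠ k : ℕ in atTop, ‖(k : ℂ) • (c k - 1)‖ < C :=
      hc.norm.eventually_lt_const (by rw [hC]; linarith)
    filter_upwards [h1, eventually_gt_atTop 0] with k hk hk0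
    have hk0' : (0 : ℝ) < k := by exact_mod_cast hk0
    rw [norm_smul, Complex.norm_natCast] at hk
    have h2 : ‖c k - 1‖ ≤ C / k := by
      rw [le_div_iff₀ hk0']; linarith
    calc ‖c k‖ = ‖(c k - 1) + 1‖ := by rw [sub_add_cancel]
      _ ≤ ‖c k - 1‖ + ‖(1 : A)‖ := norm_add_le _ _
      _ ≤ C / k + 1 := by rw [norm_one]; linarith
      _ ≤ Real.exp (C / k) := Real.add_one_le_exp _
  have hd : Tendsto (fun k : ℕ => Real.exp C * ‖(k : ℂ) • (a k - 1) - (k : ℂ) • (b k - 1)‖)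
      atTop (𝓝 0) := by
    have := ((ha.sub hb).norm).const_mul (Real.exp C)
    simpa using this
  refine squeeze_zero_norm' ?_ hd
  filter_upwards [key a ha, key b hb, eventually_gt_atTop 0] with k h1 h2 hk0
  have hk0' : (0 : ℝ) < k := by exact_mod_cast hk0
  refine (norm_pow_sub_pow_le (a k) (b k) (Real.one_le_exp (by positivity)) h1 h2 k).trans
    (le_of_eq ?_)
  rw [← smul_sub, norm_smul, Complex.norm_natCast, ← Real.exp_nat_mul,
    mul_div_cancel₀ _ hk0'.ne', sub_sub_sub_cancel_right]
  ring

theorem tendsto_smul_sub_one {γ : ℂ → A} {Z : A} (h : HasDerivAt γ Z 0) (h0 : γ 0 = 1) :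
    Tendsto (fun k : ℕ => (k : ℂ) • (γ ((k : ℂ)⁻¹) - 1)) atTop (𝓝 Z) := by
  have h1 := h.tendsto_slope_zero
  have h2 : Tendsto (fun k : ℕ => ((k : ℂ)⁻¹)) atTop (𝓝[≠] 0) := by
    refine tendsto_nhdsWithin_iff.2 ⟨tendsto_inv_atTop_nhds_zero_nat, ?_⟩
    filter_upwards [eventually_gt_atTop 0] with k hk
    simp [hk.ne']
  have := h1.comp h2
  simpa [Function.comp_def, h0] using this

theorem hasDerivAt_exp_smul_zero (X : A) :
    HasDerivAt (fun t : ℂ => NormedSpace.exp (t • X)) X 0 := by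
  simpa using hasDerivAt_exp_smul_const (𝕂 := ℂ) X 0

theorem trotter (X Y : A) :
    Tendsto (fun k : ℕ => (NormedSpace.exp ((k : ℂ)⁻¹ • X) * NormedSpace.exp ((k : ℂ)⁻¹ • Y)) ^ k)
      atTop (𝓝 (NormedSpace.exp (X + Y))) := by
  let _ : NormedAlgebra ℚ A := NormedAlgebra.restrictScalars ℚ ℂ A
  have h1 : HasDerivAt (fun t : ℂ => NormedSpace.exp (t • X) * NormedSpace.exp (t • Y))
      (X + Y) 0 := by
    have := (hasDerivAt_exp_smul_zero X).mul (hasDerivAt_exp_smul_zero Y)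
    simpa [Pi.mul_def] using this
  have h2 := tendsto_pow_sub_pow (tendsto_smul_sub_one h1 (by simp))
    (tendsto_smul_sub_one (hasDerivAt_exp_smul_zero (X + Y)) (by simp))
  have h3 := h2.add_const (NormedSpace.exp (X + Y))
  rw [zero_add] at h3
  refine h3.congr' ?_
  filter_upwards [eventually_gt_atTop 0] with k hk
  have hk' : (k : ℂ) ≠ 0 := by exact_mod_cast hk.ne'
  have : NormedSpace.exp ((k : ℂ)⁻¹ • (X + Y)) ^ k = NormedSpace.exp (X + Y) := by
    rw [← NormedSpace.exp_nsmul, ← Nat.cast_smul_eq_nsmul ℂ, smul_smul, mul_inv_cancel₀ hk',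
      one_smul]
  rw [this, sub_add_cancel]

theorem hasDerivAt_conj (X Y : A) :
    HasDerivAt (fun t : ℂ => NormedSpace.exp (t • X) * Y * NormedSpace.exp (-(t • X)))
      (X * Y - Y * X) 0 := by
  have h1 := hasDerivAt_exp_smul_zero X
  have h2 : HasDerivAt (fun t : ℂ => NormedSpace.exp (-(t • X))) (-X) 0 := by
    simpa using hasDerivAt_exp_smul_zero (-X)
  have h3 := (h1.mul_const Y).mul h2
  simpa [sub_eq_add_neg, Pi.mul_def] using h3

end Trotter

/-! ### Linear algebraic groups and their Lie algebras -/

/-- A complex linear algebraic group, given with a faithful representation on `ℂⁿ`: a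
Zariski closed subgroup of `GL n ℂ`. -/
structure LinearAlgebraicGroup (n : ℕ) where
  /-- The underlying group of invertible matrices. -/
  toSubgroup : Subgroup (GL (Fin n) ℂ)
  zariski_closed : ∃ S : Set (MvPolynomial (Fin n × Fin n) ℂ), ∀ g : GL (Fin n) ℂ,
    g ∈ toSubgroup ↔ ∀ p ∈ S, MvPolynomial.eval (fun ij => g.val ij.1 ij.2) p = 0

/-- The exponential of a matrix, as an invertible matrix. -/
noncomputable def expGL {n : ℕ} (X : Matrix (Fin n) (Fin n) ℂ) : GL (Fin n) ℂ :=
  (Matrix.isUnit_exp X).unit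

theorem expGL_val {n : ℕ} (X : Matrix (Fin n) (Fin n) ℂ) :
    (expGL X).val = NormedSpace.exp X := rfl

theorem expGL_inv_val {n : ℕ} (X : Matrix (Fin n) (Fin n) ℂ) :
    ((expGL X)⁻¹).val = NormedSpace.exp (-X) := by
  rw [Matrix.coe_units_inv, expGL_val, Matrix.exp_neg]

namespace LinearAlgebraicGroup

variable {n : ℕ}

theorem mem_of_tendsto (G : LinearAlgebraicGroup n) {u : ℕ → GL (Fin n) ℂ} {g : GL (Fin n) ℂ}
    (hu : ∀ᶠ k in atTop, u k ∈ G.toSubgroup)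
    (h : Tendsto (fun k => (u k).val) atTop (𝓝 g.val)) : g ∈ G.toSubgroup := by
  obtain ⟨S, hS⟩ := G.zariski_closed
  rw [hS]
  intro p hp
  have hc : Continuous fun M : Matrix (Fin n) (Fin n) ℂ =>
      MvPolynomial.eval (fun ij : Fin n × Fin n => M ij.1 ij.2) p := by
    refine (MvPolynomial.continuous_eval p).comp ?_
    exact continuous_pi fun ij => continuous_id.matrix_elem ij.1 ij.2
  have h1 := (hc.tendsto g.val).comp h
  refine tendsto_nhds_unique h1 ?_
  refine (tendsto_congr' ?_).2 tendsto_const_nhds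
  filter_upwards [hu] with k hk
  exact (hS _).1 hk p hp

open scoped Matrix.Norms.Operator in
theorem exp_add_mem (G : LinearAlgebraicGroup n) (X Y : Matrix (Fin n) (Fin n) ℂ)
    (hX : ∀ t : ℂ, expGL (t • X) ∈ G.toSubgroup) (hY : ∀ t : ℂ, expGL (t • Y) ∈ G.toSubgroup) :
    expGL (X + Y) ∈ G.toSubgroup := by
  rcases Nat.eq_zero_or_pos n with rfl | hn
  · rw [Subsingleton.elim (expGL (X + Y)) 1]
    exact G.toSubgroup.one_mem
  have : Nonempty (Fin n) := ⟨⟨0, hn⟩⟩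
  refine G.mem_of_tendsto
    (u := fun k : ℕ => (expGL ((k : ℂ)⁻¹ • X) * expGL ((k : ℂ)⁻¹ • Y)) ^ k)
    (Eventually.of_forall fun k => pow_mem (mul_mem (hX _) (hY _)) _) ?_
  exact trotter X Y

open scoped Matrix.Norms.Operator in
theorem lie_mem_of_conj_mem (V : Submodule ℂ (Matrix (Fin n) (Fin n) ℂ))
    (X Y : Matrix (Fin n) (Fin n) ℂ)
    (h : ∀ t : ℂ, NormedSpace.exp (t • X) * Y * NormedSpace.exp (-(t • X)) ∈ V) :
    X * Y - Y * X ∈ V := by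
  rcases Nat.eq_zero_or_pos n with rfl | hn
  · rw [Subsingleton.elim (X * Y - Y * X) 0]
    exact V.zero_mem
  have : Nonempty (Fin n) := ⟨⟨0, hn⟩⟩
  have hV : IsClosed (V : Set (Matrix (Fin n) (Fin n) ℂ)) := V.closed_of_finiteDimensional
  refine hV.mem_of_tendsto (hasDerivAt_conj X Y).tendsto_slope_zero (Eventually.of_forall ?_)
  intro t
  refine V.smul_mem _ (V.sub_mem (h _) (h _))

/-- The Lie algebra of a linear algebraic group `G`, as a vector space of matrices: all `X` whose
one-parameter group `exp (t X)`, `t ∈ ℂ`, lies in `G`. -/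
def lieSubmodule (G : LinearAlgebraicGroup n) : Submodule ℂ (Matrix (Fin n) (Fin n) ℂ) where
  carrier := {X | ∀ t : ℂ, expGL (t • X) ∈ G.toSubgroup}
  zero_mem' := by
    intro t
    have : expGL (t • (0 : Matrix (Fin n) (Fin n) ℂ)) = 1 := by
      ext1
      rw [expGL_val, smul_zero, NormedSpace.exp_zero, Units.val_one]
    rw [this]
    exact G.toSubgroup.one_mem
  add_mem' := by
    intro X Y hX hY t
    rw [smul_add]
    refine G.exp_add_mem _ _ (fun s => ?_) (fun s => ?_)
    · rw [smul_smul]; exact hX _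
    · rw [smul_smul]; exact hY _
  smul_mem' := by
    intro c X hX t
    rw [smul_smul]
    exact hX _

theorem conj_mem_lieSubmodule (G : LinearAlgebraicGroup n) {g : GL (Fin n) ℂ}
    (hg : g ∈ G.toSubgroup) {X : Matrix (Fin n) (Fin n) ℂ} (hX : X ∈ G.lieSubmodule) :
    g.val * X * (g⁻¹).val ∈ G.lieSubmodule := by
  intro t
  have : expGL (t • (g.val * X * (g⁻¹).val)) = g * expGL (t • X) * g⁻¹ := by
    ext1
    rw [expGL_val, ← smul_mul_assoc, ← mul_smul_comm, Matrix.exp_units_conj]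
    rfl
  rw [this]
  exact mul_mem (mul_mem hg (hX t)) (inv_mem hg)

/-- The Lie algebra of a linear algebraic group, with the commutator of matrices as bracket. -/
def lieAlgebra (G : LinearAlgebraicGroup n) : LieSubalgebra ℂ (Matrix (Fin n) (Fin n) ℂ) where
  toSubmodule := G.lieSubmodule
  lie_mem' := by
    intro X Y hX hY
    rw [Ring.lie_def]
    refine lie_mem_of_conj_mem G.lieSubmodule X Y fun t => ?_
    have := G.conj_mem_lieSubmodule (hX t) hY
    rwa [expGL_inv_val] at this

/-- `G` is reductive: its unipotent radical is trivial, that is, the only Zariski closed normal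
subgroup of `G` consisting of unipotent matrices is the trivial one. (A unipotent algebraic group
in characteristic zero is connected, so connectedness need not be required of `U`.) `G` itself
need not be connected. -/
def IsReductive (G : LinearAlgebraicGroup n) : Prop :=
  ∀ U : LinearAlgebraicGroup n, U.toSubgroup ≤ G.toSubgroup →
    (∀ g ∈ G.toSubgroup, ∀ u ∈ U.toSubgroup, g * u * g⁻¹ ∈ U.toSubgroup) →
    (∀ u ∈ U.toSubgroup, IsNilpotent (u.val - 1)) →
    U.toSubgroup = ⊥

end LinearAlgebraicGroup

/-! ### Gradings, the groups `G₀` and `G̃₀`, and characteristics -/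

section Grading

variable {n : ℕ} {𝔤 : LieSubalgebra ℂ (Matrix (Fin n) (Fin n) ℂ)}

/-- The graded piece `𝔤ₛ = {ξ ∈ 𝔤 | [h, ξ] = s ξ}` defined by `h ∈ 𝔤`. -/
def grade (h : 𝔤) (s : ℤ) : Submodule ℂ 𝔤 :=
  Module.End.eigenspace (LieAlgebra.ad ℂ 𝔤 h) (s : ℂ)

/-- `h` defines a `ℤ`-grading of `𝔤`, i.e. `𝔤` is the direct sum of the `𝔤ₛ`, `s ∈ ℤ`. -/
def DefinesGrading (h : 𝔤) : Prop :=
  DirectSum.IsInternal (grade h)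

/-- The orthogonal complement `𝔤̃₀` of `h` in `𝔤₀` with respect to the trace form
`(x, y) = tr (x y)` of the given faithful representation on `ℂⁿ`. -/
def reducedGradeZero (h : 𝔤) : Submodule ℂ 𝔤 where
  carrier := {ξ | ξ ∈ grade h 0 ∧ Matrix.trace (h.val * ξ.val) = 0}
  zero_mem' := ⟨(grade h 0).zero_mem, by simp⟩
  add_mem' := by
    rintro a b ⟨ha, ha'⟩ ⟨hb, hb'⟩
    refine ⟨(grade h 0).add_mem ha hb, ?_⟩
    change Matrix.trace (h.val * (a.val + b.val)) = 0
    rw [mul_add, Matrix.trace_add, ha', hb', add_zero]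
  smul_mem' := by
    rintro c a ⟨ha, ha'⟩
    refine ⟨(grade h 0).smul_mem c ha, ?_⟩
    change Matrix.trace (h.val * (c • a.val)) = 0
    rw [mul_smul_comm, Matrix.trace_smul, ha', smul_zero]

/-- The connected subgroup of `GL n ℂ` with Lie algebra `V`: the subgroup generated by the
exponentials of the elements of `V`. (A connected complex algebraic group `H` is generated
by the exponentials of its Lie algebra, so for `V` the Lie algebra of `H` this is `H`.) -/
noncomputable def connectedSubgroup (V : Submodule ℂ 𝔤) : Subgroup (GL (Fin n) ℂ) :=
  Subgroup.closure {u | ∃ ξ ∈ V, u = expGL ξ.val}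

/-- The connected subgroup `G₀` with Lie algebra `𝔤₀`. -/
noncomputable def gradeZeroGroup (h : 𝔤) : Subgroup (GL (Fin n) ℂ) :=
  connectedSubgroup (grade h 0)

/-- The reduced `θ`-group `G̃₀`: the connected subgroup with Lie algebra `𝔤̃₀`. -/
noncomputable def reducedThetaGroup (h : 𝔤) : Subgroup (GL (Fin n) ℂ) :=
  connectedSubgroup (reducedGradeZero h)

/-- The orbit of `x ∈ 𝔤` under a group of matrices acting by the adjoint action
`g • x = g x g⁻¹`. -/
def adOrbit (H : Subgroup (GL (Fin n) ℂ)) (x : 𝔤) : Set (Matrix (Fin n) (Fin n) ℂ) :=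
  {y | ∃ g ∈ H, y = g.val * x.val * (g⁻¹).val}

/-- `c` is a Dynkin characteristic of `x ∈ 𝔤₁` (with respect to the grading defined by `h`):
`c ∈ 𝔤₀` and there is `y ∈ 𝔤₋₁` such that `(c, x, y)` satisfies the `𝔰𝔩₂`-relations.
(For `x = 0` these relations force `c = 0`.) -/
def IsDynkinCharacteristic (h c x : 𝔤) : Prop :=
  c ∈ grade h 0 ∧ ∃ y ∈ grade h (-1),
    ⁅x, y⁆ = c ∧ ⁅c, x⁆ = (2 : ℂ) • x ∧ ⁅c, y⁆ = -((2 : ℂ) • y)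

end Grading

end ThetaGroup

namespace ThetaGroup

open Matrix

/-! ### Matrix exponentials and diagonalizable matrices -/

section Abstract

attribute [-instance] LieRing.ofAssociativeRing

variable {A : Type*} [NormedRing A] [NormedAlgebra ℂ A] [CompleteSpace A]

/-! Write `(a, b) = tr (ab)`. Two facts about a reductive group are needed first. The trace form is
nondegenerate on `𝔤` (`eq_zero_of_trace_mul_eq_zero`), and `h` is diagonalizable with rational
eigenvalues (`exists_eq_diagConj_rat`), so `(h, h)` is a positive sum of rational squares. Both rest
on replicas (`replica_mem`): if `X ∈ 𝔤` has semisimple part with eigenvalues `dᵢ`, then for every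
additive `φ : ℂ → ℂ` the matrix with eigenvalues `φ(dᵢ)` on the same basis lies in `𝔤`.

Since `(h, h) ≠ 0`, the group `G₀` is `G̃₀` times the one-parameter group of `h`, which only
rescales `x`. If some `z ∈ 𝔤₀` centralizes `x` and `(h, z) ≠ 0`, then a suitable `h - az` lies in
`𝔤̃₀` and rescales `x` in the same way, so the two orbits agree. If they differ, `h` is therefore
orthogonal to the centralizer of `x` in `𝔤₀`, and duality gives `h ∈ [x, 𝔤₋₁]`, which is the
characteristic condition for `2h`.

Conversely, let `2h` be a characteristic, with partner `y`, and suppose the orbits agree. Then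
`exp(h) x = g x` with `g ∈ G̃₀`, and `u = exp(-h) g` commutes with `h` and `x`, hence with `y`.
Consider `χ(g) = ∑ r log |det (g|V_r)|` over the eigenspaces `V_r` of `h`. It vanishes on `G̃₀`,
because on `exp A` it equals `Re (A, h)`. It vanishes at `u`, because a Weyl element commuting with
`u` swaps `V_r` and `V_{-r}`. But `χ(exp h) = (h, h) > 0`, a contradiction. -/

theorem exp_neg_mul_mul_exp_of_lie_lie_lie {X Z W V : A} (hW : X * Z - Z * X = W)
    (hV : X * W - W * X = V) (h0 : X * V - V * X = 0) :
    NormedSpace.exp (-X) * (Z + W + (2⁻¹ : ℂ) • V) * NormedSpace.exp X = Z := by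
  -- The curve `exp(-tX) (Z + tW + t²V/2) exp(tX)` is constant; its values at `1` and `0` are the
  -- two sides.
  have hd : ∀ t : ℂ, HasDerivAt (fun t : ℂ => NormedSpace.exp (t • (-X)) *
      (Z + t • W + (t ^ 2 * 2⁻¹) • V) * NormedSpace.exp (t • X)) 0 t := by
    intro t
    have h1 := hasDerivAt_exp_smul_const (𝕂 := ℂ) (-X) t
    have h2 := hasDerivAt_exp_smul_const' (𝕂 := ℂ) X t
    have h3 : HasDerivAt (fun t : ℂ => Z + t • W + (t ^ 2 * 2⁻¹) • V) (W + t • V) t := by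
      have e1 : HasDerivAt (fun t : ℂ => t • W) W t := by
        simpa using (hasDerivAt_id t).smul_const W
      have e2 : HasDerivAt (fun t : ℂ => (t ^ 2 * 2⁻¹) • V) (t • V) t := by
        have := ((hasDerivAt_pow 2 t).mul_const (2⁻¹ : ℂ)).smul_const V
        refine this.congr_deriv ?_
        congr 1
        norm_num
        ring
      exact (e1.const_add Z).add e2
    have h4 := (h1.mul h3).mul h2
    refine h4.congr_deriv (Eq.symm ?_)
    have e : -X * (Z + t • W + (t ^ 2 * 2⁻¹) • V) + (W + t • V)
        + (Z + t • W + (t ^ 2 * 2⁻¹) • V) * X = 0 := by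
      have e1 : Z * X = X * Z - W := by rw [← hW]; abel
      have e2 : W * X = X * W - V := by rw [← hV]; abel
      have e3 : V * X = X * V := (sub_eq_zero.1 h0).symm
      simp only [mul_add, add_mul, mul_smul_comm, smul_mul_assoc, neg_mul, e1, e2, e3, smul_sub, smul_neg]
      abel
    calc (0 : A) = NormedSpace.exp (t • (-X)) *
          (-X * (Z + t • W + (t ^ 2 * 2⁻¹) • V) + (W + t • V)
            + (Z + t • W + (t ^ 2 * 2⁻¹) • V) * X) * NormedSpace.exp (t • X) := by
          rw [e, mul_zero, zero_mul]
      _ = _ := by simp only [Pi.mul_apply]; noncomm_ring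
  have hc := is_const_of_deriv_eq_zero (fun t => (hd t).differentiableAt) (fun t => (hd t).deriv) 1 0
  simpa using hc

end Abstract

section MatrixExp

variable {m : Type*} [Fintype m] [DecidableEq m]

open scoped Matrix.Norms.Operator in
theorem semiconjBy_exp {x a b : Matrix m m ℂ} (h : x * a = b * x) :
    x * NormedSpace.exp a = NormedSpace.exp b * x := by
  let _ : NormedAlgebra ℚ (Matrix m m ℂ) := NormedAlgebra.restrictScalars ℚ ℂ _
  exact SemiconjBy.exp_right (x := x) (a := a) (b := b) h

open scoped Matrix.Norms.Operator in
theorem hasSum_exp (A : Matrix m m ℂ) :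
    HasSum (fun k : ℕ => (k.factorial⁻¹ : ℂ) • A ^ k) (NormedSpace.exp A) :=
  NormedSpace.exp_series_hasSum_exp' A

theorem exp_eq_sum_of_pow_eq_zero {A : Matrix m m ℂ} {K : ℕ} (h : A ^ K = 0) :
    NormedSpace.exp A = ∑ k ∈ Finset.range K, (k.factorial⁻¹ : ℂ) • A ^ k := by
  refine (hasSum_exp A).unique (hasSum_sum_of_ne_finset_zero fun k hk => ?_)
  rw [pow_eq_zero_of_le (by simpa using hk) h, smul_zero]

theorem exp_smul_one (c : ℂ) :
    NormedSpace.exp (c • (1 : Matrix m m ℂ)) = Complex.exp c • (1 : Matrix m m ℂ) := by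
  rw [smul_one_eq_diagonal, smul_one_eq_diagonal, Matrix.exp_diagonal]
  congr 1
  funext i
  rw [Pi.coe_exp, Complex.exp_eq_exp_ℂ]

/-- If `[A, x] = c x`, then `exp A` conjugates `x` to `exp c • x`. -/
theorem exp_mul_eq_of_lie_eq_smul {A x : Matrix m m ℂ} {c : ℂ} (h : A * x - x * A = c • x) :
    NormedSpace.exp A * x = Complex.exp c • (x * NormedSpace.exp A) := by
  -- So `x` intertwines `A + c` with `A`, hence also their exponentials.
  have h1 : x * (A + c • 1) = A * x := by
    rw [mul_add, mul_smul_comm, mul_one, ← h]; abel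
  have h2 := semiconjBy_exp h1
  rw [Matrix.exp_add_of_commute _ _ ((Commute.one_right A).smul_right c), exp_smul_one] at h2
  rw [← h2, mul_smul_comm, mul_one, mul_smul_comm]

theorem exp_mul_exp_neg (A : Matrix m m ℂ) : NormedSpace.exp A * NormedSpace.exp (-A) = 1 := by
  rw [← Matrix.exp_add_of_commute _ _ (Commute.refl A).neg_right, add_neg_cancel,
    NormedSpace.exp_zero]

open scoped Matrix.Norms.Operator in
/-- The exponential of `ad X`, on an element killed by `(ad X) ^ 3`. -/
theorem exp_conj_of_lie_lie_lie {X Z W V : Matrix m m ℂ} (hW : X * Z - Z * X = W)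
    (hV : X * W - W * X = V) (h0 : X * V - V * X = 0) :
    NormedSpace.exp X * Z = (Z + W + (2⁻¹ : ℂ) • V) * NormedSpace.exp X := by
  have h := exp_neg_mul_mul_exp_of_lie_lie_lie hW hV h0
  have h1 := exp_mul_exp_neg X
  calc NormedSpace.exp X * Z = NormedSpace.exp X *
        (NormedSpace.exp (-X) * (Z + W + (2⁻¹ : ℂ) • V) * NormedSpace.exp X) :=
          congrArg _ h.symm
    _ = (NormedSpace.exp X * NormedSpace.exp (-X)) *
        ((Z + W + (2⁻¹ : ℂ) • V) * NormedSpace.exp X) := by simp only [mul_assoc]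
    _ = _ := by rw [h1, one_mul]

/-- The matrix with eigenvalues `f` on the basis given by `Q`. -/
noncomputable def diagConj (Q : (Matrix m m ℂ)ˣ) (f : m → ℂ) : Matrix m m ℂ :=
  Q.val * diagonal f * (Q⁻¹).val

theorem diagConj_mul (Q : (Matrix m m ℂ)ˣ) (f g : m → ℂ) :
    diagConj Q f * diagConj Q g = diagConj Q (f * g) := by
  have : diagonal (f * g) = diagonal f * diagonal g := by rw [diagonal_mul_diagonal]; rfl
  simp only [diagConj, this, mul_assoc, Units.inv_mul_cancel_left]

theorem diagConj_add (Q : (Matrix m m ℂ)ˣ) (f g : m → ℂ) :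
    diagConj Q f + diagConj Q g = diagConj Q (f + g) := by
  have : diagonal (f + g) = diagonal f + diagonal g := by rw [diagonal_add]; rfl
  simp only [diagConj, this, mul_add, add_mul]

theorem diagConj_smul (Q : (Matrix m m ℂ)ˣ) (c : ℂ) (f : m → ℂ) :
    c • diagConj Q f = diagConj Q (c • f) := by
  simp only [diagConj, diagonal_smul, mul_smul_comm, smul_mul_assoc]

theorem diagConj_neg (Q : (Matrix m m ℂ)ˣ) (f : m → ℂ) :
    -diagConj Q f = diagConj Q (-f) := by
  simpa using diagConj_smul Q (-1) f

theorem diagConj_zero (Q : (Matrix m m ℂ)ˣ) : diagConj Q 0 = 0 := by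
  simpa using (diagConj_smul Q 0 0).symm

theorem trace_diagConj (Q : (Matrix m m ℂ)ˣ) (f : m → ℂ) : (diagConj Q f).trace = ∑ i, f i := by
  rw [diagConj, trace_mul_comm, ← mul_assoc, Units.inv_mul, one_mul, trace_diagonal]

theorem exp_diagConj (Q : (Matrix m m ℂ)ˣ) (f : m → ℂ) :
    NormedSpace.exp (diagConj Q f) = diagConj Q (fun i => Complex.exp (f i)) := by
  rw [diagConj, Matrix.exp_units_conj, Matrix.exp_diagonal, diagConj]
  congr 3
  funext i
  rw [Pi.coe_exp, Complex.exp_eq_exp_ℂ]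

theorem mul_diagConj_eq_iff (Q : (Matrix m m ℂ)ˣ) (f g : m → ℂ) (A : Matrix m m ℂ) :
    A * diagConj Q f = diagConj Q g * A ↔
      ∀ i j, ((Q⁻¹).val * A * Q.val) i j * (f j - g i) = 0 := by
  have h1 : A * diagConj Q f = diagConj Q g * A ↔
      ((Q⁻¹).val * A * Q.val) * diagonal f = diagonal g * ((Q⁻¹).val * A * Q.val) := by
    rw [← (Q⁻¹).isUnit.mul_right_inj (b := A * diagConj Q f),
      ← Q.isUnit.mul_left_inj (b := (Q⁻¹).val * (A * diagConj Q f))]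
    simp only [diagConj, mul_assoc, Units.inv_mul_cancel_left, Units.inv_mul, mul_one]
  rw [h1, ← Matrix.ext_iff]
  refine forall_congr' fun i => forall_congr' fun j => ?_
  rw [mul_diagonal, diagonal_mul, ← sub_eq_zero]
  rw [mul_sub, mul_comm (g i)]

/-- What intertwines two matrices with the same eigenbasis intertwines their functions. -/
theorem mul_diagConj_comp {Q : (Matrix m m ℂ)ˣ} {f g : m → ℂ} {A : Matrix m m ℂ}
    (h : A * diagConj Q f = diagConj Q g * A) (φ : ℂ → ℂ) :
    A * diagConj Q (φ ∘ f) = diagConj Q (φ ∘ g) * A := by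
  rw [mul_diagConj_eq_iff] at h ⊢
  intro i j
  rcases mul_eq_zero.1 (h i j) with h | h
  · rw [h, zero_mul]
  · rw [Function.comp, Function.comp, sub_eq_zero.1 h, sub_self, mul_zero]

theorem exists_eq_diagConj_of_isSemisimple (S : Matrix m m ℂ)
    (hS : Module.End.IsSemisimple (Matrix.toLin' S)) :
    ∃ (Q : (Matrix m m ℂ)ˣ) (d : m → ℂ), S = diagConj Q d := by
  classical
  have htop := hS.iSup_eigenspace_eq_top
  have hint : DirectSum.IsInternal (Module.End.eigenspace (Matrix.toLin' S)) :=
    DirectSum.isInternal_submodule_of_iSupIndep_of_iSup_eq_top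
      (Module.End.eigenspaces_iSupIndep _) htop
  let b0 := hint.collectedBasis fun μ => Module.Free.chooseBasis ℂ _
  let e := b0.indexEquiv (Pi.basisFun ℂ m)
  let b := b0.reindex e
  have hb : ∀ i, ∃ μ : ℂ, S *ᵥ (b i) = μ • b i := by
    intro i
    refine ⟨(e.symm i).1, ?_⟩
    have := hint.collectedBasis_mem (fun μ => Module.Free.chooseBasis ℂ _) (e.symm i)
    rw [Module.End.mem_eigenspace_iff] at this
    rw [Module.Basis.reindex_apply]
    exact this
  choose d hd using hb
  let P : Matrix m m ℂ := (Pi.basisFun ℂ m).toMatrix b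
  have hP : ∀ i j, P i j = b j i := fun i j => by
    simp [P, Module.Basis.toMatrix_apply]
  have h1 : P * b.toMatrix (Pi.basisFun ℂ m) = 1 := Module.Basis.toMatrix_mul_toMatrix_flip _ _
  have h2 : b.toMatrix (Pi.basisFun ℂ m) * P = 1 := Module.Basis.toMatrix_mul_toMatrix_flip _ _
  refine ⟨⟨P, b.toMatrix (Pi.basisFun ℂ m), h1, h2⟩, d, ?_⟩
  have h3 : S * P = P * diagonal d := by
    ext i j
    rw [mul_diagonal, hP]
    have := congr_fun (hd j) i
    simp only [mulVec, dotProduct, Pi.smul_apply, smul_eq_mul] at this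
    rw [mul_comm, ← this, mul_apply]
    simp only [hP]
  change S = P * diagonal d * b.toMatrix (Pi.basisFun ℂ m)
  rw [← h3, mul_assoc, h1, mul_one]

/-- The Jordan decomposition of a complex matrix. -/
theorem exists_jordan (X : Matrix m m ℂ) :
    ∃ (Q : (Matrix m m ℂ)ˣ) (d : m → ℂ) (N : Matrix m m ℂ), X = diagConj Q d + N ∧
      IsNilpotent N ∧ Commute (diagConj Q d) N ∧ ∀ Y, Commute X Y → Commute N Y := by
  obtain ⟨N', hN', S', hS', hnil, hss, hX⟩ :=
    Module.End.exists_isNilpotent_isSemisimple (f := Matrix.toLin' X)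
  -- Both Jordan parts are polynomials in `X`, so they commute with whatever commutes with `X`.
  have key : ∀ A ∈ Algebra.adjoin ℂ {Matrix.toLin' X}, ∀ Y, Commute X Y →
      Commute (LinearMap.toMatrix' A) Y := by
    intro A hA Y hXY
    have h1 : Commute (Matrix.toLin' Y) A := by
      refine Algebra.commute_of_mem_adjoin_of_forall_mem_commute hA ?_
      rintro _ rfl
      exact (hXY.symm.map (Matrix.toLinAlgEquiv' (R := ℂ) (n := m)))
    have h2 := h1.symm.map (LinearMap.toMatrixAlgEquiv' (R := ℂ) (n := m))
    have h3 : LinearMap.toMatrixAlgEquiv' (Matrix.toLin' Y) = Y := LinearMap.toMatrix'_toLin' Y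
    rw [h3] at h2
    exact h2
  have hXe : X = LinearMap.toMatrix' S' + LinearMap.toMatrix' N' := by
    rw [← map_add, add_comm, ← hX, LinearMap.toMatrix'_toLin']
  obtain ⟨Q, d, hQ⟩ := exists_eq_diagConj_of_isSemisimple (LinearMap.toMatrix' S')
    (by rwa [Matrix.toLin'_toMatrix'])
  refine ⟨Q, d, LinearMap.toMatrix' N', ?_, ?_, ?_, key N' hN'⟩
  · rw [← hQ]; exact hXe
  · exact hnil.map (LinearMap.toMatrixAlgEquiv' (R := ℂ) (n := m))
  · rw [← hQ]
    exact key S' hS' _ (key N' hN' X rfl).symm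

/-- The characteristic polynomial of `-N` is a power of the variable; evaluate it at `1`. -/
theorem det_one_add_of_isNilpotent {N : Matrix m m ℂ} (hN : IsNilpotent N) : (1 + N).det = 1 := by
  have h := (Matrix.isNilpotent_charpoly_sub_pow_of_isNilpotent hN.neg).eq_zero
  rw [sub_eq_zero] at h
  have h2 := Matrix.eval_charpoly (-N) 1
  rw [h] at h2
  simpa using h2.symm

theorem trace_mul_eq_zero_of_commute {A N : Matrix m m ℂ} (hN : IsNilpotent N) (h : Commute N A) :
    (N * A).trace = 0 :=
  (Matrix.isNilpotent_trace_of_isNilpotent (h.isNilpotent_mul_right hN)).eq_zero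

theorem exists_exp_sub_one_eq {A : Matrix m m ℂ} (hA : IsNilpotent A) :
    ∃ B, Commute A B ∧ NormedSpace.exp A - 1 = A * B := by
  obtain ⟨K, hK⟩ := hA
  refine ⟨∑ k ∈ Finset.range K, ((k + 1).factorial⁻¹ : ℂ) • A ^ k, ?_, ?_⟩
  · exact Commute.sum_right _ _ _ fun k _ => ((Commute.refl A).pow_right k).smul_right _
  · rw [exp_eq_sum_of_pow_eq_zero (K := K + 1) (by rw [pow_succ, hK, zero_mul]),
      Finset.sum_range_succ', Finset.mul_sum]
    simp [pow_succ']

/-- By the Jordan decomposition: the diagonalizable part gives the exponential of the trace, and the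
unipotent factor has determinant `1`. -/
theorem det_exp (A : Matrix m m ℂ) : (NormedSpace.exp A).det = Complex.exp A.trace := by
  obtain ⟨Q, d, N, rfl, ⟨K, hK⟩, hc, -⟩ := exists_jordan A
  have hnil : IsNilpotent N := ⟨K, hK⟩
  have h1 : (NormedSpace.exp N).det = 1 := by
    have : IsNilpotent (NormedSpace.exp N - 1) := by
      obtain ⟨B, hB, h⟩ := exists_exp_sub_one_eq hnil
      rw [h]
      exact hB.isNilpotent_mul_right hnil
    simpa using det_one_add_of_isNilpotent this
  rw [Matrix.exp_add_of_commute _ _ hc, det_mul, h1, mul_one, exp_diagConj, trace_add,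
    (Matrix.isNilpotent_trace_of_isNilpotent hnil).eq_zero, add_zero, trace_diagConj, diagConj,
    det_mul, det_mul, det_diagonal, mul_right_comm, ← det_mul, Units.mul_inv, det_one, one_mul,
    Complex.exp_sum]

end MatrixExp

/-! ### Independence of exponential polynomials -/

section ExpPoly

open Polynomial

/-- Translation of functions on `ℂ` by `c`. -/
def shift (c : ℂ) : Module.End ℂ (ℂ → ℂ) := LinearMap.funLeft ℂ ℂ (fun t => t + c)

theorem shift_apply (c : ℂ) (f : ℂ → ℂ) (t : ℂ) : shift c f t = f (t + c) := rfl

/-- The function `q(t) exp(μ t)`. -/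
noncomputable def expPoly (μ : ℂ) (q : ℂ[X]) : ℂ → ℂ := fun t => q.eval t * Complex.exp (t * μ)

/-- Up to the factor `exp(cμ)`, the operator replaces `q(t)` by `q(t + c) - q(t)`, which lowers the
degree. -/
theorem shift_sub_pow_expPoly (c μ : ℂ) (k : ℕ) :
    ∀ q : ℂ[X], q.degree < k →
      ((shift c - algebraMap ℂ (Module.End ℂ (ℂ → ℂ)) (Complex.exp (c * μ))) ^ k)
        (expPoly μ q) = 0 := by
  induction k with
  | zero =>
    intro q hq
    have : q = 0 := by simpa using hq
    funext t
    simp [this, expPoly]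
  | succ k ih =>
    intro q hq
    have h1 : (shift c - algebraMap ℂ (Module.End ℂ (ℂ → ℂ)) (Complex.exp (c * μ)))
        (expPoly μ q) = Complex.exp (c * μ) • expPoly μ (taylor c q - q) := by
      funext t
      simp only [expPoly, LinearMap.sub_apply, Module.algebraMap_end_apply, Pi.sub_apply,
        Pi.smul_apply, smul_eq_mul, shift_apply, eval_sub, taylor_eval, add_mul, Complex.exp_add]
      ring
    rw [pow_succ, Module.End.mul_apply, h1, map_smul, ih, smul_zero]
    by_cases hq0 : q = 0
    · simp [hq0, bot_lt_iff_ne_bot]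
    · have h2 : (taylor c q - q).degree < q.degree := by
        rw [← degree_taylor q c]
        exact degree_sub_lt_left (degree_taylor q c) (by simpa using hq0) (leadingCoeff_taylor c q)
      rw [degree_eq_natDegree hq0] at hq h2
      refine h2.trans_le ?_
      norm_cast at hq ⊢
      omega

theorem expPoly_mem (μ : ℂ) (q : ℂ[X]) :
    expPoly μ q ∈ ⨅ c : ℂ, (shift c).maxGenEigenspace (Complex.exp (c * μ)) := by
  rw [Submodule.mem_iInf]
  intro c
  rw [Module.End.mem_maxGenEigenspace]
  exact ⟨q.natDegree + 1, shift_sub_pow_expPoly c μ _ q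
    (degree_le_natDegree.trans_lt (by exact_mod_cast Nat.lt_succ_self _))⟩

/-- The translations commute, so their simultaneous generalized eigenspaces for distinct systems of
eigenvalues are independent. -/
theorem iSupIndep_shift : iSupIndep fun μ : ℂ =>
    ⨅ c : ℂ, (shift c).maxGenEigenspace (Complex.exp (c * μ)) := by
  have h := Module.End.independent_iInf_maxGenEigenspace_of_forall_mapsTo shift
    (fun i j φ => Module.End.mapsTo_maxGenEigenspace_of_comm (by
      refine LinearMap.ext fun f => funext fun t => ?_
      simp only [Module.End.mul_apply, shift_apply, add_right_comm]) φ)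
  refine h.comp (f := fun μ c => Complex.exp (c * μ)) fun μ ν hμν => ?_
  by_contra hne
  have h0 : μ - ν ≠ 0 := sub_ne_zero.2 hne
  -- For this translation the two eigenvalues have ratio `e ≠ 1`.
  have h1 := congr_fun hμν (μ - ν)⁻¹
  have h2 : Complex.exp ((μ - ν)⁻¹ * (μ - ν)) = 1 := by
    rw [mul_sub, Complex.exp_sub]
    simp only at h1
    rw [h1, div_self (Complex.exp_ne_zero _)]
  rw [inv_mul_cancel₀ h0] at h2
  have h3 := congrArg norm h2
  rw [Complex.norm_exp] at h3
  simp at h3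

/-- The ring of formal exponential polynomials. -/
abbrev ExpPolyRing : Type := AddMonoidAlgebra ℂ[X] ℂ

/-- The evaluation `q ⊗ [μ] ↦ q(t) exp(φ μ)`. -/
noncomputable def evalExpPoly (t : ℂ) (φ : ℂ →+ ℂ) : ExpPolyRing →+* ℂ :=
  AddMonoidAlgebra.liftNCRingHom (evalRingHom t)
    { toFun := fun μ => Complex.exp (φ μ.toAdd)
      map_one' := by simp
      map_mul' := fun a b => by simp [Complex.exp_add] }
    (fun _ _ => Commute.all _ _)

theorem evalExpPoly_single (t : ℂ) (φ : ℂ →+ ℂ) (μ : ℂ) (q : ℂ[X]) :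
    evalExpPoly t φ (AddMonoidAlgebra.single μ q) = q.eval t * Complex.exp (φ μ) :=
  AddMonoidAlgebra.liftNC_single _ _ _ _

/-- An identity that holds for the functions `exp(tμ)` holds formally, so it survives replacing `tμ`
by any additive function of `μ`, independently of `t`. -/
theorem eq_zero_of_evalExpPoly (a : ExpPolyRing)
    (h : ∀ t, evalExpPoly t (AddMonoidHom.mulLeft t) a = 0) : a = 0 := by
  have h1 : ∑ μ ∈ a.coeff.support, expPoly μ (a.coeff μ) = 0 := by
    funext t
    rw [Finset.sum_apply, Pi.zero_apply, ← h t]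
    conv_rhs => rw [← AddMonoidAlgebra.sum_coeff_single a]
    rw [Finsupp.sum, map_sum]
    refine Finset.sum_congr rfl fun μ _ => ?_
    rw [evalExpPoly_single]
    rfl
  have h2 := (iSupIndep_iff_finsetSum_eq_zero_imp_eq_zero _).1 iSupIndep_shift a.coeff.support
    (fun μ => expPoly μ (a.coeff μ)) (fun μ _ => expPoly_mem μ _) h1
  ext μ : 2
  by_contra hne
  have h3 := h2 μ (Finsupp.mem_support_iff.2 hne)
  apply hne
  refine Polynomial.funext fun t => ?_
  have h4 := congr_fun h3 t
  simpa [expPoly, Complex.exp_ne_zero] using h4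

/-- Constants in the ring of formal exponential polynomials. -/
noncomputable def constExpPoly : ℂ →+* ExpPolyRing :=
  AddMonoidAlgebra.singleZeroRingHom.comp C

theorem evalExpPoly_const (t : ℂ) (φ : ℂ →+ ℂ) (z : ℂ) :
    evalExpPoly t φ (constExpPoly z) = z := by
  change evalExpPoly t φ (AddMonoidAlgebra.single 0 (C z)) = z
  simp [evalExpPoly_single]

end ExpPoly

/-! ### Replicas of the elements of the Lie algebra of an algebraic group -/

section Replica

open Matrix Polynomial

variable {n : ℕ}

/-- The entries of `exp(tX)` are exponential polynomials in `t`. The equations of `G` hold for all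
`t`, hence formally, hence also after setting `t = 0` in the polynomial coefficients and sending the
formal exponential `[μ]` to `exp(φ μ)`. -/
theorem expGL_replica_mem (G : LinearAlgebraicGroup n) {Q : GL (Fin n) ℂ}
    {d : Fin n → ℂ} {N : Matrix (Fin n) (Fin n) ℂ} (hN : IsNilpotent N)
    (hc : Commute (diagConj Q d) N) (hX : diagConj Q d + N ∈ G.lieSubmodule) (φ : ℂ →+ ℂ) :
    expGL (diagConj Q (φ ∘ d)) ∈ G.toSubgroup := by
  obtain ⟨K, hK⟩ := hN
  obtain ⟨S, hS⟩ := G.zariski_closed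
  let ι := constExpPoly.mapMatrix (m := Fin n)
  -- The formal `exp(tX)`: the eigenvalue `exp(t dᵢ)` becomes the group element `[dᵢ]`, and
  -- `exp(tN)` is a finite sum with polynomial coefficients.
  let E : Matrix (Fin n) (Fin n) ExpPolyRing :=
    ι Q.val * diagonal (fun i => AddMonoidAlgebra.single (d i) 1) * ι (Q⁻¹).val *
      ∑ k ∈ Finset.range K, (AddMonoidAlgebra.single (0 : ℂ) (C (k.factorial⁻¹ : ℂ) * X ^ k)) •
        ι (N ^ k)
  have hE : ∀ t ψ, (evalExpPoly t ψ).mapMatrix E =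
      diagConj Q (fun i => Complex.exp (ψ (d i))) *
        ∑ k ∈ Finset.range K, (k.factorial⁻¹ : ℂ) • (t • N) ^ k := by
    intro t ψ
    have hι : ∀ M, (evalExpPoly t ψ).mapMatrix (ι M) = M := by
      intro M
      ext i j
      exact evalExpPoly_const t ψ _
    have hs : ∀ (a : ExpPolyRing) (M : Matrix (Fin n) (Fin n) ExpPolyRing),
        (evalExpPoly t ψ).mapMatrix (a • M) =
          evalExpPoly t ψ a • (evalExpPoly t ψ).mapMatrix M := by
      intro a M
      ext i j
      simp
    have hd : (evalExpPoly t ψ).mapMatrix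
        (diagonal (fun i => AddMonoidAlgebra.single (d i) (1 : ℂ[X]))) =
          diagonal (fun i => Complex.exp (ψ (d i))) := by
      rw [RingHom.mapMatrix_apply, diagonal_map (map_zero _)]
      congr 1
      funext i
      simp [evalExpPoly_single]
    simp only [E, map_mul, map_sum, hι, hs, hd, diagConj, evalExpPoly_single]
    congr 1
    refine Finset.sum_congr rfl fun k _ => ?_
    simp [_root_.smul_pow, smul_smul]
  have hexp : ∀ t : ℂ, (evalExpPoly t (AddMonoidHom.mulLeft t)).mapMatrix E =
      (expGL (t • (diagConj Q d + N))).val := by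
    intro t
    rw [hE, expGL_val, smul_add, Matrix.exp_add_of_commute _ _ ((hc.smul_left t).smul_right t),
      diagConj_smul, exp_diagConj,
      exp_eq_sum_of_pow_eq_zero (A := t • N) (K := K) (by rw [_root_.smul_pow, hK, smul_zero])]
    rfl
  have hrep : (evalExpPoly 0 φ).mapMatrix E = (expGL (diagConj Q (φ ∘ d))).val := by
    rw [hE, expGL_val, exp_diagConj]
    rcases Nat.eq_zero_or_pos K with rfl | hK0
    · have : Subsingleton (Matrix (Fin n) (Fin n) ℂ) :=
        subsingleton_of_zero_eq_one (by simpa using hK.symm)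
      exact Subsingleton.elim _ _
    · rw [Finset.sum_eq_single_of_mem 0 (Finset.mem_range.2 hK0)]
      · simp
      · intro k _ hk
        rw [zero_smul, zero_pow hk, smul_zero]
  have heval : ∀ (p : MvPolynomial (Fin n × Fin n) ℂ) t ψ,
      evalExpPoly t ψ (p.eval₂ constExpPoly fun ij => E ij.1 ij.2) =
        MvPolynomial.eval (fun ij => (evalExpPoly t ψ).mapMatrix E ij.1 ij.2) p := by
    intro p t ψ
    rw [MvPolynomial.hom_eval₂]
    have : (evalExpPoly t ψ).comp constExpPoly = RingHom.id ℂ :=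
      RingHom.ext (evalExpPoly_const t ψ)
    rw [this]
    rfl
  rw [hS]
  intro p hp
  rw [← hrep, ← heval, eq_zero_of_evalExpPoly (p.eval₂ constExpPoly fun ij => E ij.1 ij.2),
    map_zero]
  intro t
  rw [heval, hexp]
  exact (hS _).1 (hX t) p hp

/-- The Lie algebra of an algebraic group contains the replicas of its elements. -/
theorem replica_mem (G : LinearAlgebraicGroup n) {Q : GL (Fin n) ℂ}
    {d : Fin n → ℂ} {N : Matrix (Fin n) (Fin n) ℂ} (hN : IsNilpotent N)
    (hc : Commute (diagConj Q d) N) (hX : diagConj Q d + N ∈ G.lieSubmodule) (φ : ℂ →+ ℂ) :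
    diagConj Q (φ ∘ d) ∈ G.lieSubmodule := by
  intro t
  rw [diagConj_smul]
  exact expGL_replica_mem G hN hc hX ((AddMonoidHom.mulLeft t).comp φ)

end Replica

open Matrix

/-! ### Nondegeneracy of the trace form -/

section RatLinear

variable {ι : Type*} [Fintype ι]

/-- A `ℚ`-linear functional on `ℂ`, with values in `ℂ`. -/
noncomputable def ratFunctional (φ : ℂ →ₗ[ℚ] ℚ) : ℂ →+ ℂ :=
  (algebraMap ℚ ℂ).toAddMonoidHom.comp φ.toAddMonoidHom

theorem ratFunctional_apply (φ : ℂ →ₗ[ℚ] ℚ) (z : ℂ) : ratFunctional φ z = (φ z : ℚ) := rfl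

/-- Since `φ` is `ℚ`-linear with rational values, applying it to the relation gives `∑ φ(dᵢ)² = 0`
over `ℚ`. -/
theorem apply_eq_zero_of_sum_mul_ratFunctional (φ : ℂ →ₗ[ℚ] ℚ) (d : ι → ℂ)
    (h : ∑ i, d i * ratFunctional φ (d i) = 0) (i : ι) : φ (d i) = 0 := by
  have h1 : ∑ i, φ (d i) * φ (d i) = 0 := by
    rw [← map_zero φ, ← h, map_sum]
    refine Finset.sum_congr rfl fun i _ => ?_
    rw [ratFunctional_apply, mul_comm (d i), ← Rat.smul_def, map_smul, smul_eq_mul]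
  have h2 := (Finset.sum_eq_zero_iff_of_nonneg fun i _ => mul_self_nonneg _).1 h1 i
    (Finset.mem_univ i)
  exact mul_self_eq_zero.1 h2

end RatLinear

variable {n : ℕ}

theorem trace_mul_replica {Q : GL (Fin n) ℂ} {d : Fin n → ℂ} {N : Matrix (Fin n) (Fin n) ℂ}
    (hN : IsNilpotent N) (hc : Commute (diagConj Q d) N) (φ : ℂ → ℂ) :
    ((diagConj Q d + N) * diagConj Q (φ ∘ d)).trace = ∑ i, d i * φ (d i) := by
  have h1 : Commute N (diagConj Q (φ ∘ d)) := mul_diagConj_comp hc.symm φ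
  rw [add_mul, trace_add, trace_mul_eq_zero_of_commute hN h1, add_zero, diagConj_mul,
    trace_diagConj]
  rfl

/-- In the Lie algebra of an algebraic group, the elements of the radical of the trace form are
nilpotent. -/
theorem isNilpotent_of_trace_mul_eq_zero (G : LinearAlgebraicGroup n)
    {X : Matrix (Fin n) (Fin n) ℂ} (hX : X ∈ G.lieSubmodule)
    (h : ∀ Y ∈ G.lieSubmodule, (X * Y).trace = 0) : IsNilpotent X := by
  obtain ⟨Q, d, N, rfl, hN, hc, -⟩ := exists_jordan X
  have hd : d = 0 := by
    funext i
    -- The `ℚ`-linear functionals separate the points of `ℂ`.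
    rw [Pi.zero_apply, ← Module.forall_dual_apply_eq_zero_iff ℚ]
    intro φ
    refine apply_eq_zero_of_sum_mul_ratFunctional φ d ?_ i
    rw [← trace_mul_replica hN hc (ratFunctional φ)]
    exact h _ (replica_mem G hN hc hX _)
  rwa [hd, diagConj_zero, zero_add]

/-- The descending flag `ℂⁿ ⊇ V ℂⁿ ⊇ V (V ℂⁿ) ⊇ ⋯` of a space `V` of matrices. -/
def flag (V : Submodule ℂ (Matrix (Fin n) (Fin n) ℂ)) : ℕ → Submodule ℂ (Fin n → ℂ)
  | 0 => ⊤
  | k + 1 => Submodule.span ℂ {w | ∃ X ∈ V, ∃ v ∈ flag V k, w = X *ᵥ v}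

theorem mulVec_mem_flag_succ {V : Submodule ℂ (Matrix (Fin n) (Fin n) ℂ)} {k : ℕ}
    {X : Matrix (Fin n) (Fin n) ℂ} (hX : X ∈ V) {v : Fin n → ℂ} (hv : v ∈ flag V k) :
    X *ᵥ v ∈ flag V (k + 1) :=
  Submodule.subset_span ⟨X, hX, v, hv, rfl⟩

theorem flag_succ_le (V : Submodule ℂ (Matrix (Fin n) (Fin n) ℂ)) (k : ℕ) :
    flag V (k + 1) ≤ flag V k := by
  induction k with
  | zero => exact le_top
  | succ k ih =>
    refine Submodule.span_le.2 ?_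
    rintro _ ⟨X, hX, v, hv, rfl⟩
    exact mulVec_mem_flag_succ hX (ih hv)

/-- By induction, from `g X v = (g X g⁻¹) (g v)`. -/
theorem mulVec_mem_flag_of_conj {V : Submodule ℂ (Matrix (Fin n) (Fin n) ℂ)} {g : GL (Fin n) ℂ}
    (hg : ∀ X ∈ V, g.val * X * (g⁻¹).val ∈ V) (k : ℕ) :
    ∀ v ∈ flag V k, g.val *ᵥ v ∈ flag V k := by
  induction k with
  | zero => exact fun _ _ => Submodule.mem_top
  | succ k ih =>
    intro v hv
    have : flag V (k + 1) ≤ (flag V (k + 1)).comap (Matrix.mulVecLin g.val) := by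
      refine Submodule.span_le.2 ?_
      rintro _ ⟨X, hX, v, hv, rfl⟩
      have h1 := mulVec_mem_flag_succ (hg X hX) (ih v hv)
      rw [mulVec_mulVec, mul_assoc, Units.inv_mul, mul_one, ← mulVec_mulVec] at h1
      exact h1
    exact this hv

/-- Engel's theorem: the flag of a Lie algebra of nilpotent matrices ends in zero. -/
theorem exists_flag_eq_bot (V : Submodule ℂ (Matrix (Fin n) (Fin n) ℂ))
    (hlie : ∀ X ∈ V, ∀ Y ∈ V, X * Y - Y * X ∈ V) (hnil : ∀ X ∈ V, IsNilpotent X) :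
    ∃ k, flag V k = ⊥ := by
  let L : LieSubalgebra ℂ (Module.End ℂ (Fin n → ℂ)) :=
    { V.map (Matrix.toLinAlgEquiv' (R := ℂ) (n := Fin n)).toLinearMap with
      lie_mem' := by
        rintro _ _ ⟨X, hX, rfl⟩ ⟨Y, hY, rfl⟩
        refine ⟨X * Y - Y * X, hlie X hX Y hY, ?_⟩
        simp [Ring.lie_def] }
  have hL : ∀ X (hX : X ∈ V), Matrix.toLinAlgEquiv' X ∈ L := fun X hX => ⟨X, hX, rfl⟩
  have hnilp : LieModule.IsNilpotent L (Fin n → ℂ) := by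
    rw [LieModule.isNilpotent_iff_forall (R := ℂ)]
    rintro ⟨_, X, hX, rfl⟩
    exact (hnil X hX).map (Matrix.toLinAlgEquiv' (R := ℂ) (n := Fin n))
  -- The flag is bounded by the lower central series of `ℂⁿ` over this Lie algebra, which reaches
  -- zero by Engel's theorem.
  have hle : ∀ k, flag V k ≤ (LieModule.lowerCentralSeries ℂ L (Fin n → ℂ) k).toSubmodule := by
    intro k
    induction k with
    | zero => simp
    | succ k ih =>
      refine Submodule.span_le.2 ?_
      rintro _ ⟨X, hX, v, hv, rfl⟩
      rw [LieModule.lowerCentralSeries_succ]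
      exact LieSubmodule.lie_mem_lie (x := (⟨_, hL X hX⟩ : L)) (LieSubmodule.mem_top _) (ih hv)
  obtain ⟨k, hk⟩ := LieModule.IsNilpotent.nilpotent ℂ L (Fin n → ℂ)
  refine ⟨k, ?_⟩
  have := hle k
  rw [hk] at this
  simpa using this

theorem exists_mvPolynomial_eval_eq (ℓ : Matrix (Fin n) (Fin n) ℂ →ₗ[ℂ] ℂ) (c : ℂ) :
    ∃ p : MvPolynomial (Fin n × Fin n) ℂ, ∀ M : Matrix (Fin n) (Fin n) ℂ,
      MvPolynomial.eval (fun ij => M ij.1 ij.2) p = ℓ M - c := by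
  refine ⟨(∑ i, ∑ j, MvPolynomial.C (ℓ (Matrix.single i j 1)) * MvPolynomial.X (i, j)) -
    MvPolynomial.C c, fun M => ?_⟩
  conv_rhs => rw [Matrix.matrix_eq_sum_single M]
  simp only [map_sub, map_sum, map_mul, MvPolynomial.eval_C, MvPolynomial.eval_X]
  congr 1
  refine Finset.sum_congr rfl fun i _ => Finset.sum_congr rfl fun j _ => ?_
  have : Matrix.single i j (M i j) = M i j • Matrix.single i j (1 : ℂ) := by
    rw [Matrix.smul_single, smul_eq_mul, mul_one]
  rw [this, map_smul, smul_eq_mul, mul_comm]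

/-- The subgroup of those elements of `G` that act trivially on the quotients of the flag of a
`G`-stable space `V` of matrices. -/
def flagSubgroup (G : LinearAlgebraicGroup n) (V : Submodule ℂ (Matrix (Fin n) (Fin n) ℂ))
    (hV : ∀ g ∈ G.toSubgroup, ∀ X ∈ V, g.val * X * (g⁻¹).val ∈ V) : LinearAlgebraicGroup n where
  toSubgroup :=
    { carrier := {u | u ∈ G.toSubgroup ∧
        ∀ k, ∀ v ∈ flag V k, u.val *ᵥ v - v ∈ flag V (k + 1)}
      mul_mem' := by
        rintro a b ⟨ha, ha'⟩ ⟨hb, hb'⟩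
        refine ⟨mul_mem ha hb, fun k v hv => ?_⟩
        have h1 := ha' k _ (mulVec_mem_flag_of_conj (hV b hb) k v hv)
        have h2 := add_mem h1 (hb' k v hv)
        rw [sub_add_sub_cancel, mulVec_mulVec] at h2
        exact h2
      one_mem' := ⟨one_mem _, fun k v _ => by simp⟩
      inv_mem' := by
        rintro a ⟨ha, ha'⟩
        refine ⟨inv_mem ha, fun k v hv => ?_⟩
        have h0 := mulVec_mem_flag_of_conj (hV _ (inv_mem ha)) k v hv
        have h1 := neg_mem (ha' k _ h0)
        rw [neg_sub, mulVec_mulVec, Units.mul_inv, one_mulVec] at h1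
        exact h1 }
  zariski_closed := by
    obtain ⟨S, hS⟩ := G.zariski_closed
    -- Membership of `gv - v` in the next step of the flag is tested by the functionals vanishing
    -- there, each test being affine in `g`.
    refine ⟨S ∪ {p | ∃ k, ∃ v ∈ flag V k, ∃ ℓ : Module.Dual ℂ (Fin n → ℂ),
      (∀ w ∈ flag V (k + 1), ℓ w = 0) ∧ ∀ M : Matrix (Fin n) (Fin n) ℂ,
        MvPolynomial.eval (fun ij => M ij.1 ij.2) p = ℓ (M *ᵥ v) - ℓ v}, fun g => ?_⟩
    constructor
    · rintro ⟨hg, hg'⟩ p (hp | ⟨k, v, hv, ℓ, hℓ, hp⟩)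
      · exact (hS g).1 hg p hp
      · rw [hp, ← map_sub]
        exact hℓ _ (hg' k v hv)
    · intro h
      refine ⟨(hS g).2 fun p hp => h p (Or.inl hp), fun k v hv => ?_⟩
      by_contra hne
      obtain ⟨ℓ, hℓ, hker⟩ := Submodule.exists_le_ker_of_notMem hne
      obtain ⟨p, hp⟩ := exists_mvPolynomial_eval_eq
        (ℓ.comp ((Matrix.mulVecBilin ℂ ℂ).flip v)) (ℓ v)
      refine hℓ ?_
      rw [map_sub]
      refine (hp g.val).symm.trans (h p (Or.inr ⟨k, v, hv, ℓ, fun w hw => hker hw, hp⟩))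

/-- For nilpotent `X` one has `exp X - 1 = X (1 + XC)` with `C` a polynomial in `X`, and the second
factor is a unit. -/
theorem eq_zero_of_exp_eq_one {X : Matrix (Fin n) (Fin n) ℂ} (hX : IsNilpotent X)
    (h : NormedSpace.exp X = 1) : X = 0 := by
  obtain ⟨K, hK⟩ := hX
  let C := ∑ k ∈ Finset.range K, ((k + 2).factorial⁻¹ : ℂ) • X ^ k
  have hC : Commute X C :=
    Commute.sum_right _ _ _ fun k _ => ((Commute.refl X).pow_right k).smul_right _
  have h1 : X * (1 + X * C) = 0 := by
    have h2 := exp_eq_sum_of_pow_eq_zero (A := X) (K := K + 2)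
      (by rw [pow_add, hK, zero_mul])
    rw [h, Finset.sum_range_succ', Finset.sum_range_succ'] at h2
    simpa [C, Finset.mul_sum, pow_succ', mul_add, add_comm X] using h2
  have hunit : IsUnit (1 + X * C) := (hC.isNilpotent_mul_right ⟨K, hK⟩).isUnit_one_add
  exact (hunit.mul_left_eq_zero).1 h1

/-- The trace form is nondegenerate on the Lie algebra of a reductive group. -/
theorem eq_zero_of_trace_mul_eq_zero (G : LinearAlgebraicGroup n) (hG : G.IsReductive)
    {X : Matrix (Fin n) (Fin n) ℂ} (hX : X ∈ G.lieSubmodule)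
    (h : ∀ Y ∈ G.lieSubmodule, (X * Y).trace = 0) : X = 0 := by
  -- The radical of the trace form: a `G`-stable ideal of nilpotent matrices.
  let V : Submodule ℂ (Matrix (Fin n) (Fin n) ℂ) :=
    { carrier := {X | X ∈ G.lieSubmodule ∧ ∀ Y ∈ G.lieSubmodule, (X * Y).trace = 0}
      zero_mem' := ⟨zero_mem _, fun Y _ => by simp⟩
      add_mem' := fun {a b} ha hb => ⟨add_mem ha.1 hb.1, fun Y hY => by
        rw [add_mul, trace_add, ha.2 Y hY, hb.2 Y hY, add_zero]⟩
      smul_mem' := fun c a ha => ⟨Submodule.smul_mem _ c ha.1, fun Y hY => by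
        rw [smul_mul_assoc, trace_smul, ha.2 Y hY, smul_zero]⟩ }
  have hnil : ∀ X ∈ V, IsNilpotent X := fun X hX => isNilpotent_of_trace_mul_eq_zero G hX.1 hX.2
  have hbr : ∀ X ∈ G.lieSubmodule, ∀ Y ∈ G.lieSubmodule, X * Y - Y * X ∈ G.lieSubmodule := by
    intro X hX Y hY
    have := G.lieAlgebra.lie_mem hX hY
    rwa [Ring.lie_def] at this
  have hlie : ∀ X ∈ V, ∀ Y ∈ V, X * Y - Y * X ∈ V := by
    intro X hX Y hY
    refine ⟨hbr X hX.1 Y hY.1, fun Z hZ => ?_⟩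
    have h1 := hX.2 _ (hbr Y hY.1 Z hZ)
    rw [mul_sub, trace_sub] at h1
    rw [sub_mul, trace_sub, mul_assoc, mul_assoc, trace_mul_comm Y, mul_assoc]
    exact h1
  have hV : ∀ g ∈ G.toSubgroup, ∀ X ∈ V, g.val * X * (g⁻¹).val ∈ V := by
    intro g hg X hX
    refine ⟨G.conj_mem_lieSubmodule hg hX.1, fun Y hY => ?_⟩
    have h1 := hX.2 _ (G.conj_mem_lieSubmodule (inv_mem hg) hY)
    rw [inv_inv] at h1
    rw [mul_assoc, mul_assoc, trace_mul_comm, ← h1]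
    simp only [mul_assoc]
  obtain ⟨K, hK⟩ := exists_flag_eq_bot V hlie hnil
  -- The flag subgroup is normal because `V` is `G`-stable, and unipotent because `u - 1` pushes the
  -- flag down to zero.
  have htriv := hG (flagSubgroup G V hV) (fun u hu => hu.1) (by
      rintro g hg u ⟨hu, hu'⟩
      refine ⟨mul_mem (mul_mem hg hu) (inv_mem hg), fun k v hv => ?_⟩
      have h1 := mulVec_mem_flag_of_conj (hV _ (inv_mem hg)) k v hv
      have h2 := mulVec_mem_flag_of_conj (hV _ hg) (k + 1) _ (hu' k _ h1)
      rw [mulVec_sub, mulVec_mulVec, mulVec_mulVec, mulVec_mulVec, Units.mul_inv,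
        one_mulVec] at h2
      simpa [mul_assoc] using h2) (by
      rintro u ⟨-, hu'⟩
      refine ⟨K, ?_⟩
      have h1 : ∀ k v, ((u.val - 1) ^ k) *ᵥ v ∈ flag V k := by
        intro k
        induction k with
        | zero => exact fun v => Submodule.mem_top
        | succ k ih =>
          intro v
          have h2 := hu' k _ (ih v)
          rwa [pow_succ', ← mulVec_mulVec, sub_mulVec, one_mulVec]
      refine Matrix.ext_iff_mulVec.2 fun v => ?_
      have h2 := h1 K v
      rw [hK] at h2
      simpa using h2)
  have hXV : X ∈ V := ⟨hX, h⟩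
  have hXn : IsNilpotent X := hnil X hXV
  -- Each positive power of `X` lowers the flag, so `exp X` lies in this trivial group.
  have hmem : expGL X ∈ (flagSubgroup G V hV).toSubgroup := by
    refine ⟨by simpa using hX 1, fun k v hv => ?_⟩
    have hpow : ∀ j, X ^ j *ᵥ v ∈ flag V k := by
      intro j
      induction j with
      | zero => simpa using hv
      | succ j ih =>
        rw [pow_succ', ← mulVec_mulVec]
        exact flag_succ_le V k (mulVec_mem_flag_succ hXV ih)
    obtain ⟨J, hJ⟩ := hXn
    have h2 := exp_eq_sum_of_pow_eq_zero (A := X) (K := J + 1) (by rw [pow_succ, hJ, zero_mul])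
    rw [Finset.sum_range_succ'] at h2
    rw [expGL_val, h2, add_mulVec]
    simp only [pow_zero, Nat.factorial_zero, Nat.cast_one, inv_one, one_smul, one_mulVec,
      add_sub_cancel_right, sum_mulVec, smul_mulVec, pow_succ', ← mulVec_mulVec]
    exact Submodule.sum_mem _ fun j _ => Submodule.smul_mem _ _
      (mulVec_mem_flag_succ hXV (hpow j))
  rw [htriv, Subgroup.mem_bot] at hmem
  exact eq_zero_of_exp_eq_one hXn (by rw [← expGL_val, hmem, Units.val_one])

open Matrix

/-! ### Gradings of the Lie algebra of a reductive group -/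

section GradeLemmas

variable {n : ℕ} {𝔤 : LieSubalgebra ℂ (Matrix (Fin n) (Fin n) ℂ)}

theorem mem_grade_iff {h ξ : 𝔤} {s : ℤ} :
    ξ ∈ grade h s ↔ h.val * ξ.val - ξ.val * h.val = (s : ℂ) • ξ.val := by
  rw [grade, Module.End.mem_eigenspace_iff, LieAlgebra.ad_apply, ← Subtype.coe_inj]
  rw [LieSubalgebra.coe_bracket, Ring.lie_def]
  rfl

theorem mem_grade_zero_iff {h ξ : 𝔤} : ξ ∈ grade h 0 ↔ Commute h.val ξ.val := by
  rw [mem_grade_iff, Int.cast_zero, zero_smul, sub_eq_zero]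
  rfl

theorem DefinesGrading.induction {h : 𝔤} (hg : DefinesGrading h) {P : 𝔤 → Prop}
    (hP : ∀ s, ∀ ξ ∈ grade h s, P ξ) (h0 : P 0) (hadd : ∀ ξ η, P ξ → P η → P (ξ + η)) (ξ : 𝔤) :
    P ξ := by
  have hmem : ξ ∈ ⨆ s, grade h s := by
    rw [DirectSum.IsInternal.submodule_iSup_eq_top hg]; exact Submodule.mem_top
  exact Submodule.iSup_induction _ (motive := P) hmem hP h0 hadd

/-- Invariance under `ad h` gives `(s + t) (ξ, η) = 0`. -/
theorem trace_mul_eq_zero_of_grade {h ξ η : 𝔤} {s t : ℤ} (hξ : ξ ∈ grade h s)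
    (hη : η ∈ grade h t) (hst : s + t ≠ 0) : (ξ.val * η.val).trace = 0 := by
  rw [mem_grade_iff] at hξ hη
  have h1 : (h.val * ξ.val * η.val - ξ.val * h.val * η.val).trace =
      s * (ξ.val * η.val).trace := by
    rw [← sub_mul, hξ, smul_mul_assoc, trace_smul, smul_eq_mul]
  have h2 : (ξ.val * (h.val * η.val) - ξ.val * (η.val * h.val)).trace =
      t * (ξ.val * η.val).trace := by
    rw [← mul_sub, hη, mul_smul_comm, trace_smul, smul_eq_mul]
  rw [trace_sub, mul_assoc, mul_assoc, trace_mul_comm] at h1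
  rw [trace_sub] at h2
  have h3 : ((s + t : ℤ) : ℂ) * (ξ.val * η.val).trace = 0 := by
    push_cast
    rw [add_mul, ← h1, ← h2, ← mul_assoc ξ.val η.val]
    ring
  exact (mul_eq_zero.1 h3).resolve_left (by exact_mod_cast hst)

theorem trace_mul_eq_zero_of_mem_derived {h : 𝔤} (hd : h ∈ LieAlgebra.derivedSeries ℂ 𝔤 1)
    {R : Matrix (Fin n) (Fin n) ℂ} (hR : ∀ ξ : 𝔤, Commute R ξ.val) : (R * h.val).trace = 0 := by
  rw [LieAlgebra.derivedSeries_def, LieAlgebra.derivedSeriesOfIdeal_succ,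
    LieAlgebra.derivedSeriesOfIdeal_zero, ← LieSubmodule.mem_toSubmodule,
    LieSubmodule.lieIdeal_oper_eq_linear_span'] at hd
  induction hd using Submodule.span_induction with
  | mem z hz =>
    obtain ⟨a, -, b, -, rfl⟩ := hz
    rw [LieSubalgebra.coe_bracket, Ring.lie_def, mul_sub, trace_sub, ← mul_assoc, (hR a).eq,
      mul_assoc, trace_mul_comm, mul_assoc, sub_self]
  | zero => simp
  | add a b _ _ ha hb =>
    change (R * (a.val + b.val)).trace = 0
    rw [mul_add, trace_add, ha, hb, add_zero]
  | smul c a _ ha =>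
    change (R * (c • a.val)).trace = 0
    rw [mul_smul_comm, trace_smul, ha, smul_zero]

end GradeLemmas

variable {n : ℕ} {G : LinearAlgebraicGroup n}

theorem exists_rat_of_dual_apply_eq_zero {z : ℂ}
    (h : ∀ φ : ℂ →ₗ[ℚ] ℚ, φ 1 = 0 → φ z = 0) : ∃ q : ℚ, z = q := by
  by_contra hne
  push Not at hne
  have hz : z ∉ Submodule.span ℚ {(1 : ℂ)} := by
    rw [Submodule.mem_span_singleton]
    rintro ⟨q, hq⟩
    refine hne q ?_
    rw [← hq, Rat.smul_def, mul_one]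
  obtain ⟨φ, hφ, hker⟩ := Submodule.exists_le_ker_of_notMem hz
  exact hφ (h φ (hker (Submodule.mem_span_singleton_self _)))

/-- The nilpotent part `N` of `h` lies in `𝔤`. It commutes with `𝔤₀`, so it is orthogonal to `𝔤₀`;
having degree `0`, it is orthogonal to the other `𝔤ₛ`. Nondegeneracy gives `N = 0`. -/
theorem exists_eq_diagConj_of_definesGrading (hG : G.IsReductive) {h : G.lieAlgebra}
    (hgrading : DefinesGrading h) :
    ∃ (Q : GL (Fin n) ℂ) (d : Fin n → ℂ), h.val = diagConj Q d := by
  obtain ⟨Q, d, N, hQ, hN, hc, hcomm⟩ := exists_jordan h.val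
  have hmem : diagConj Q d + N ∈ G.lieSubmodule := hQ ▸ h.2
  have hNmem : N ∈ G.lieSubmodule := by
    have h1 := replica_mem G hN hc hmem (AddMonoidHom.id ℂ)
    have h2 := sub_mem hmem h1
    simpa using h2
  have hNh : Commute N h.val := hcomm _ rfl
  have hzero : ∀ ξ : G.lieAlgebra, (N * ξ.val).trace = 0 := by
    refine hgrading.induction (fun s ξ hξ => ?_) (by simp) (fun ξ η hξ hη => ?_)
    · rcases eq_or_ne s 0 with rfl | hs
      · exact trace_mul_eq_zero_of_commute hN (hcomm _ (mem_grade_zero_iff.1 hξ))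
      · exact trace_mul_eq_zero_of_grade (ξ := ⟨N, hNmem⟩) (s := 0)
          (mem_grade_zero_iff.2 hNh.symm) hξ (by simpa using hs)
    · change (N * (ξ.val + η.val)).trace = 0
      rw [mul_add, trace_add, hξ, hη, add_zero]
  have hN0 := eq_zero_of_trace_mul_eq_zero G hG hNmem fun Y hY => hzero ⟨Y, hY⟩
  exact ⟨Q, d, by rw [hQ, hN0, add_zero]⟩

/-- An element of the derived algebra that defines a `ℤ`-grading is diagonalizable with rational
eigenvalues. -/
theorem exists_eq_diagConj_rat (hG : G.IsReductive) {h : G.lieAlgebra}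
    (hderived : h ∈ LieAlgebra.derivedSeries ℂ G.lieAlgebra 1) (hgrading : DefinesGrading h) :
    ∃ (Q : GL (Fin n) ℂ) (d : Fin n → ℚ), h.val = diagConj Q (fun i => (d i : ℂ)) := by
  obtain ⟨Q, d, hQ⟩ := exists_eq_diagConj_of_definesGrading hG hgrading
  suffices ∀ i, ∃ q : ℚ, d i = q by
    choose q hq using this
    exact ⟨Q, q, by rw [hQ]; congr 1; exact funext hq⟩
  intro i
  -- A functional `φ` that kills `1` does not see integer shifts of eigenvalues, so the replica
  -- `φ(h)` commutes with every `𝔤ₛ`. It is then orthogonal to `[𝔤, 𝔤] ∋ h`, that is, `∑ dᵢ φ(dᵢ) =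
  -- 0`.
  refine exists_rat_of_dual_apply_eq_zero fun φ hφ => ?_
  refine apply_eq_zero_of_sum_mul_ratFunctional φ d ?_ i
  have hint : ∀ k : ℤ, φ (k : ℂ) = 0 := by
    intro k
    have : (k : ℂ) = (k : ℚ) • (1 : ℂ) := by rw [Rat.smul_def]; simp
    rw [this, map_smul, hφ, smul_zero]
  have hR : ∀ ξ : G.lieAlgebra, Commute (diagConj Q (ratFunctional φ ∘ d)) ξ.val := by
    refine hgrading.induction (fun s ξ hξ => ?_) (Commute.zero_right _)
      (fun ξ η hξ hη => hξ.add_right hη)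
    rw [mem_grade_iff, hQ] at hξ
    have h1 : ξ.val * diagConj Q d = diagConj Q (fun i => d i - s) * ξ.val := by
      have h2 : diagConj Q (fun i => d i - s) = diagConj Q d - (s : ℂ) • 1 := by
        have h3 : (s : ℂ) • (1 : Matrix (Fin n) (Fin n) ℂ) = diagConj Q (fun _ => (s : ℂ)) := by
          rw [diagConj, ← smul_one_eq_diagonal, mul_smul_comm, smul_mul_assoc, mul_one,
            Units.mul_inv]
        rw [h3, sub_eq_add_neg, diagConj_neg, diagConj_add]
        congr 1
      rw [h2, sub_mul, smul_mul_assoc, one_mul, ← hξ]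
      abel
    have h4 := mul_diagConj_comp h1 (ratFunctional φ)
    have h5 : (ratFunctional φ) ∘ (fun i => d i - s) = ratFunctional φ ∘ d := by
      funext i
      simp only [Function.comp, map_sub]
      rw [ratFunctional_apply φ s, hint, Rat.cast_zero, sub_zero]
    rw [h5] at h4
    exact h4.symm
  have h6 := trace_mul_eq_zero_of_mem_derived hderived hR
  rw [hQ, diagConj_mul, trace_diagConj] at h6
  rw [← h6]
  exact Finset.sum_congr rfl fun i _ => mul_comm _ _

theorem trace_sq_diagConj_rat {Q : GL (Fin n) ℂ} {d : Fin n → ℚ} :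
    (diagConj Q (fun i => (d i : ℂ)) * diagConj Q (fun i => (d i : ℂ))).trace =
      ((∑ i, d i * d i : ℚ) : ℂ) := by
  rw [diagConj_mul, trace_diagConj]
  push_cast
  rfl

theorem sum_mul_self_pos {Q : GL (Fin n) ℂ} {d : Fin n → ℚ}
    (h : diagConj Q (fun i => (d i : ℂ)) ≠ 0) : 0 < ∑ i, d i * d i := by
  refine lt_of_le_of_ne (Finset.sum_nonneg fun i _ => mul_self_nonneg _) fun h0 => h ?_
  have h1 := (Finset.sum_eq_zero_iff_of_nonneg fun i _ => mul_self_nonneg (d i)).1 h0.symm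
  rw [← diagConj_zero Q]
  congr 1
  funext i
  simpa using h1 i (Finset.mem_univ i)

/-! ### Orbits of the reduced group -/

theorem exp_conj_eq_smul {A x : Matrix (Fin n) (Fin n) ℂ} {c : ℂ}
    (h : A * x - x * A = c • x) :
    (expGL A).val * x * ((expGL A)⁻¹).val = Complex.exp c • x := by
  rw [expGL_inv_val, expGL_val, exp_mul_eq_of_lie_eq_smul h, smul_mul_assoc, mul_assoc,
    exp_mul_exp_neg, mul_one]

theorem expGL_add {A B : Matrix (Fin n) (Fin n) ℂ} (h : Commute A B) :
    expGL (A + B) = expGL A * expGL B := by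
  ext1
  exact Matrix.exp_add_of_commute _ _ h

theorem commute_expGL {A B : Matrix (Fin n) (Fin n) ℂ} (h : Commute A B) :
    Commute A (expGL B).val := semiconjBy_exp h

theorem commute_of_mem_gradeZeroGroup {𝔤 : LieSubalgebra ℂ (Matrix (Fin n) (Fin n) ℂ)} {h : 𝔤}
    {g : GL (Fin n) ℂ} (hg : g ∈ gradeZeroGroup h) : Commute h.val g.val := by
  induction hg using Subgroup.closure_induction with
  | mem g hg =>
    obtain ⟨ξ, hξ, rfl⟩ := hg
    exact commute_expGL (mem_grade_zero_iff.1 hξ)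
  | one => exact Commute.one_right _
  | mul a b _ _ ha hb => exact ha.mul_right hb
  | inv a _ ha => exact ha.units_inv_right

theorem reducedThetaGroup_le {𝔤 : LieSubalgebra ℂ (Matrix (Fin n) (Fin n) ℂ)} (h : 𝔤) :
    reducedThetaGroup h ≤ gradeZeroGroup h :=
  Subgroup.closure_mono fun _ ⟨ξ, hξ, e⟩ => ⟨ξ, hξ.1, e⟩

/-- If `(h, h) ≠ 0`, then `G₀` is the product of `G̃₀` and the one-parameter group of `h`. -/
theorem exists_eq_mul_expGL {𝔤 : LieSubalgebra ℂ (Matrix (Fin n) (Fin n) ℂ)} {h : 𝔤}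
    (hne : (h.val * h.val).trace ≠ 0) {g : GL (Fin n) ℂ} (hg : g ∈ gradeZeroGroup h) :
    ∃ u ∈ reducedThetaGroup h, ∃ t : ℂ, g = u * expGL (t • h.val) := by
  have hcomm : ∀ u ∈ reducedThetaGroup h, ∀ t : ℂ, u * expGL (t • h.val) = expGL (t • h.val) * u :=
    fun u hu t => Units.ext <| commute_expGL
      (((commute_of_mem_gradeZeroGroup (reducedThetaGroup_le h hu)).smul_left t).symm)
  have hexp : ∀ s t : ℂ, expGL ((s + t) • h.val) = expGL (s • h.val) * expGL (t • h.val) := by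
    intro s t
    rw [add_smul]
    exact expGL_add (((Commute.refl _).smul_left s).smul_right t)
  induction hg using Subgroup.closure_induction with
  | mem g hg =>
    obtain ⟨ξ, hξ, rfl⟩ := hg
    have hξ' := mem_grade_zero_iff.1 hξ
    -- The coefficient of the orthogonal projection of `ξ` to the line of `h`.
    let t := (h.val * ξ.val).trace / (h.val * h.val).trace
    refine ⟨expGL (ξ - t • h).val, Subgroup.subset_closure ⟨ξ - t • h, ⟨?_, ?_⟩, rfl⟩, t, ?_⟩
    · exact sub_mem hξ (Submodule.smul_mem _ t (mem_grade_zero_iff.2 rfl))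
    · change (h.val * (ξ.val - t • h.val)).trace = 0
      rw [mul_sub, mul_smul_comm, trace_sub, trace_smul, smul_eq_mul, div_mul_cancel₀ _ hne,
        sub_self]
    · rw [← expGL_add]
      · change _ = expGL (ξ.val - t • h.val + t • h.val)
        rw [sub_add_cancel]
      · exact ((hξ'.symm.sub_left ((Commute.refl _).smul_left t)).smul_right t)
  | one => exact ⟨1, one_mem _, 0, by
      ext1; rw [one_mul, zero_smul, expGL_val, NormedSpace.exp_zero, Units.val_one]⟩
  | mul a b _ _ ha hb =>
    obtain ⟨u, hu, s, rfl⟩ := ha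
    obtain ⟨v, hv, t, rfl⟩ := hb
    refine ⟨u * v, mul_mem hu hv, s + t, ?_⟩
    rw [hexp, mul_assoc, ← mul_assoc _ v, ← hcomm v hv, mul_assoc, mul_assoc]
  | inv a _ ha =>
    obtain ⟨u, hu, t, rfl⟩ := ha
    refine ⟨u⁻¹, inv_mem hu, -t, ?_⟩
    rw [_root_.mul_inv_rev, hcomm _ (inv_mem hu)]
    congr 1
    rw [inv_eq_iff_mul_eq_one, ← hexp]
    ext1
    rw [add_neg_cancel, zero_smul, expGL_val, NormedSpace.exp_zero, Units.val_one]

/-- Both `exp(th)` and `exp(tξ)` multiply `x` by `exp t`, so the factor `exp(th)` of an element of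
`G₀` can be traded for one in `G̃₀`. -/
theorem adOrbit_eq_of_lie_eq {𝔤 : LieSubalgebra ℂ (Matrix (Fin n) (Fin n) ℂ)} {h x ξ : 𝔤}
    (hne : (h.val * h.val).trace ≠ 0) (hx : x ∈ grade h 1) (hξ : ξ ∈ reducedGradeZero h)
    (hξx : ξ.val * x.val - x.val * ξ.val = x.val) :
    adOrbit (reducedThetaGroup h) x = adOrbit (gradeZeroGroup h) x := by
  apply Set.Subset.antisymm
  · rintro y ⟨g, hg, rfl⟩
    exact ⟨g, reducedThetaGroup_le h hg, rfl⟩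
  · rintro y ⟨g, hg, rfl⟩
    obtain ⟨u, hu, t, rfl⟩ := exists_eq_mul_expGL hne hg
    refine ⟨u * expGL (t • ξ.val), mul_mem hu (Subgroup.subset_closure
      ⟨t • ξ, Submodule.smul_mem _ t hξ, rfl⟩), ?_⟩
    have key : ∀ A : Matrix (Fin n) (Fin n) ℂ, A * x.val - x.val * A = x.val →
        (expGL (t • A)).val * x.val * ((expGL (t • A))⁻¹).val = Complex.exp t • x.val := by
      intro A hA
      refine exp_conj_eq_smul ?_
      rw [smul_mul_assoc, mul_smul_comm, ← smul_sub, hA]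
    have h1 := key h.val (by simpa using mem_grade_iff.1 hx)
    have h2 := h1.trans (key ξ.val hξx).symm
    have e : ∀ E : GL (Fin n) ℂ, (u * E).val * x.val * ((u * E)⁻¹).val =
        u.val * (E.val * x.val * (E⁻¹).val) * (u⁻¹).val := by
      intro E
      rw [_root_.mul_inv_rev, Units.val_mul, Units.val_mul]
      simp only [mul_assoc]
    rw [e, e, h2]

open Matrix

/-! ### Characteristics from the trace form -/

section Duality

variable {n : ℕ}

theorem lie_mem_grade {𝔤 : LieSubalgebra ℂ (Matrix (Fin n) (Fin n) ℂ)} {h ξ η : 𝔤} {s t : ℤ}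
    (hξ : ξ ∈ grade h s) (hη : η ∈ grade h t) : ⁅ξ, η⁆ ∈ grade h (s + t) := by
  rw [grade, Module.End.mem_eigenspace_iff, LieAlgebra.ad_apply] at hξ hη ⊢
  rw [leibniz_lie, hξ, hη, smul_lie, lie_smul, ← add_smul, Int.cast_add]

theorem exists_grade_zero_trace_eq {𝔤 : LieSubalgebra ℂ (Matrix (Fin n) (Fin n) ℂ)} {h : 𝔤}
    (hgrading : DefinesGrading h) (ξ : 𝔤) :
    ∃ ξ₀ ∈ grade h 0, ∀ w ∈ grade h 0, (ξ.val * w.val).trace = (ξ₀.val * w.val).trace := by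
  refine hgrading.induction (P := fun ξ => ∃ ξ₀ ∈ grade h 0, ∀ w ∈ grade h 0,
      (ξ.val * w.val).trace = (ξ₀.val * w.val).trace)
    (fun s ξ hξ => ?_) ⟨0, zero_mem _, fun _ _ => rfl⟩
    (fun ξ η ⟨a, ha, ha'⟩ ⟨b, hb, hb'⟩ => ⟨a + b, add_mem ha hb, fun w hw => ?_⟩) ξ
  · rcases eq_or_ne s 0 with rfl | hs
    · exact ⟨ξ, hξ, fun _ _ => rfl⟩
    · refine ⟨0, zero_mem _, fun w hw => ?_⟩
      rw [trace_mul_eq_zero_of_grade hξ hw (by simpa using hs)]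
      simp
  · change ((ξ.val + η.val) * w.val).trace = ((a.val + b.val) * w.val).trace
    rw [add_mul, add_mul, trace_add, trace_add, ha' w hw, hb' w hw]

variable {G : LinearAlgebraicGroup n}

/-- The trace form as a map to the dual space. -/
noncomputable def traceDual (𝔤 : LieSubalgebra ℂ (Matrix (Fin n) (Fin n) ℂ)) :
    𝔤 →ₗ[ℂ] Module.Dual ℂ 𝔤 :=
  LinearMap.mk₂ ℂ (fun ξ η => (ξ.val * η.val).trace)
    (fun a b c => by
      change ((a.val + b.val) * c.val).trace = _
      rw [add_mul, trace_add])
    (fun r a b => by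
      change ((r • a.val) * b.val).trace = _
      rw [smul_mul_assoc, trace_smul])
    (fun a b c => by
      change (a.val * (b.val + c.val)).trace = _
      rw [mul_add, trace_add])
    (fun r a b => by
      change (a.val * (r • b.val)).trace = _
      rw [mul_smul_comm, trace_smul])

theorem traceDual_surjective (hG : G.IsReductive) :
    Function.Surjective (traceDual G.lieAlgebra) := by
  refine (LinearMap.injective_iff_surjective_of_finrank_eq_finrank
    Subspace.dual_finrank_eq.symm).1 ?_
  rw [injective_iff_map_eq_zero]
  intro ξ hξ
  ext1
  exact eq_zero_of_trace_mul_eq_zero G hG ξ.2 fun Y hY => LinearMap.congr_fun hξ ⟨Y, hY⟩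

/-- If `h` is orthogonal to the centralizer of `x ∈ 𝔤₁` in `𝔤₀`, then `h ∈ [x, 𝔤₋₁]`. -/
theorem exists_lie_eq_of_orthogonal (hG : G.IsReductive) {h x : G.lieAlgebra}
    (hgrading : DefinesGrading h) (hx : x ∈ grade h 1)
    (horth : ∀ z ∈ grade h 0, Commute z.val x.val → (h.val * z.val).trace = 0) :
    ∃ y ∈ grade h (-1), ⁅x, y⁆ = h := by
  by_contra hne
  have hnot : h ∉ (grade h (-1)).map (LieAlgebra.ad ℂ G.lieAlgebra x : G.lieAlgebra →ₗ[ℂ] _) := by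
    rintro ⟨y, hy, e⟩
    exact hne ⟨y, hy, e⟩
  obtain ⟨ℓ, hℓ, hker⟩ := Submodule.exists_le_ker_of_notMem hnot
  -- The separating functional is pairing with some `ξ`; on `𝔤₀` only its degree `0` part `ξ₀`
  -- matters.
  obtain ⟨ξ, rfl⟩ := traceDual_surjective hG ℓ
  obtain ⟨ξ₀, hξ₀, htr⟩ := exists_grade_zero_trace_eq hgrading ξ
  have hh : h ∈ grade h 0 := mem_grade_zero_iff.2 rfl
  -- Against `𝔤₋₁` this is `(ξ₀, [x, η]) = 0`; against the other degrees it is automatic. Hence `ξ₀`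
  -- centralizes `x`, and the hypothesis forces `(h, ξ₀) = 0`.
  have hbr : ∀ η : G.lieAlgebra, (⁅ξ₀, x⁆.val * η.val).trace = 0 := by
    refine hgrading.induction (fun s η hη => ?_) (by simp) (fun a b ha hb => ?_)
    · have h1 : ⁅ξ₀, x⁆ ∈ grade h (0 + 1) := lie_mem_grade hξ₀ hx
      rcases eq_or_ne s (-1) with rfl | hs
      · have h2 : ⁅x, η⁆ ∈ grade h (1 + -1) := lie_mem_grade hx hη
        rw [add_neg_cancel] at h2
        have h3 : (ξ.val * ⁅x, η⁆.val).trace = 0 := hker ⟨η, hη, rfl⟩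
        rw [htr _ h2, LieSubalgebra.coe_bracket, Ring.lie_def, mul_sub, trace_sub] at h3
        rw [LieSubalgebra.coe_bracket, Ring.lie_def, sub_mul, trace_sub, mul_assoc, mul_assoc,
          trace_mul_comm x.val, mul_assoc]
        exact h3
      · exact trace_mul_eq_zero_of_grade h1 hη (by omega)
    · change (⁅ξ₀, x⁆.val * (a.val + b.val)).trace = 0
      rw [mul_add, trace_add, ha, hb, add_zero]
  have hcomm : ⁅ξ₀, x⁆.val = 0 :=
    eq_zero_of_trace_mul_eq_zero G hG ⁅ξ₀, x⁆.2 fun Y hY => hbr ⟨Y, hY⟩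
  rw [LieSubalgebra.coe_bracket, Ring.lie_def, sub_eq_zero] at hcomm
  refine hℓ ?_
  change (ξ.val * h.val).trace = 0
  rw [htr h hh, trace_mul_comm]
  exact horth ξ₀ hξ₀ hcomm

theorem isDynkinCharacteristic_of_adOrbit_ne (hG : G.IsReductive) {h x : G.lieAlgebra}
    (hne : (h.val * h.val).trace ≠ 0) (hgrading : DefinesGrading h) (hx : x ∈ grade h 1)
    (horb : adOrbit (reducedThetaGroup h) x ≠ adOrbit (gradeZeroGroup h) x) :
    IsDynkinCharacteristic h ((2 : ℂ) • h) x := by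
  have hh : h ∈ grade h 0 := mem_grade_zero_iff.2 rfl
  obtain ⟨y, hy, hxy⟩ := exists_lie_eq_of_orthogonal hG hgrading hx fun z hz hzx => by
    by_contra hz0
    -- Chosen to make `h - az` orthogonal to `h`; it still acts on `x` as `h` does.
    let a := (h.val * h.val).trace / (h.val * z.val).trace
    refine horb (adOrbit_eq_of_lie_eq (ξ := h - a • z) hne hx
      ⟨sub_mem hh (Submodule.smul_mem _ a hz), ?_⟩ ?_)
    · change (h.val * (h.val - a • z.val)).trace = 0
      rw [mul_sub, mul_smul_comm, trace_sub, trace_smul, smul_eq_mul, div_mul_cancel₀ _ hz0,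
        sub_self]
    · change (h.val - a • z.val) * x.val - x.val * (h.val - a • z.val) = x.val
      have h1 : h.val * x.val - x.val * h.val = x.val := by simpa using mem_grade_iff.1 hx
      rw [sub_mul, mul_sub, smul_mul_assoc, mul_smul_comm, hzx.eq, sub_sub_sub_cancel_right, h1]
  have h1 : ⁅h, x⁆ = x := by
    have := Module.End.mem_eigenspace_iff.1 hx
    simpa using this
  have h2 : ⁅h, y⁆ = -y := by
    have := Module.End.mem_eigenspace_iff.1 hy
    simpa using this
  refine ⟨Submodule.smul_mem _ _ hh, (2 : ℂ) • y, Submodule.smul_mem _ _ hy, ?_, ?_, ?_⟩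
  · rw [lie_smul, hxy]
  · rw [smul_lie, h1]
  · rw [smul_lie, lie_smul, h2, smul_neg, smul_neg]

end Duality

/-! ### A character of `G₀` that is trivial on `G̃₀` -/

section Character

variable {m : Type*} [Fintype m] [DecidableEq m]

/-- The determinant of `M` on the image of a projection `P` that commutes with `M`. -/
noncomputable def detOn (P M : Matrix m m ℂ) : ℂ := (M * P + (1 - P)).det

theorem detOn_mul {P M N : Matrix m m ℂ} (hP : P * P = P) (hN : Commute N P) :
    detOn P (M * N) = detOn P M * detOn P N := by
  rw [detOn, detOn, detOn, ← det_mul]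
  congr 1
  have h1 : P * (N * P) = N * P := by rw [← mul_assoc, ← hN.eq, mul_assoc, hP]
  simp only [add_mul, mul_add, mul_sub, sub_mul, mul_assoc, mul_one, one_mul, h1, hP]
  abel

theorem detOn_one (P : Matrix m m ℂ) : detOn P 1 = 1 := by simp [detOn]

theorem detOn_ne_zero {P : Matrix m m ℂ} (hP : P * P = P) {g : (Matrix m m ℂ)ˣ}
    (hg : Commute g.val P) : detOn P g.val ≠ 0 := by
  have h1 := detOn_mul (M := g.val) hP (N := (g⁻¹).val) hg.units_inv_left
  rw [Units.mul_inv, detOn_one] at h1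
  exact left_ne_zero_of_mul (h1 ▸ one_ne_zero)

/-- The matrix `exp(A) P + (1 - P)` equals `exp(AP)`. -/
theorem detOn_exp {P A : Matrix m m ℂ} (hP : P * P = P) (hA : Commute A P) :
    detOn P (NormedSpace.exp A) = Complex.exp (A * P).trace := by
  rw [← det_exp, detOn]
  congr 1
  have h1 : P * NormedSpace.exp A = NormedSpace.exp (A * P) * P := semiconjBy_exp (by
    rw [mul_assoc, hP, hA.eq])
  have h2 : (1 - P) * NormedSpace.exp 0 = NormedSpace.exp (A * P) * (1 - P) := semiconjBy_exp (by
    rw [mul_zero, mul_sub, mul_one, mul_assoc, hP, sub_self])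
  have h3 : NormedSpace.exp A * P = P * NormedSpace.exp A := (semiconjBy_exp hA.symm.eq).symm
  rw [NormedSpace.exp_zero, mul_one] at h2
  rw [h3, h1, h2, ← mul_add, add_sub_cancel, mul_one]

theorem detOn_eq_of_semiconj {P P' M : Matrix m m ℂ} {w : (Matrix m m ℂ)ˣ}
    (hP : w.val * P = P' * w.val) (hM : Commute w.val M) : detOn P' M = detOn P M := by
  have h1 : w.val * (M * P + (1 - P)) = (M * P' + (1 - P')) * w.val := by
    rw [mul_add, add_mul, mul_sub, sub_mul, mul_one, one_mul, hP, ← mul_assoc, hM.eq, mul_assoc,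
      hP, mul_assoc]
  have h2 := congrArg det h1
  rw [det_mul, det_mul, mul_comm] at h2
  exact (mul_right_cancel₀ ((Matrix.isUnit_iff_isUnit_det _).1 w.isUnit).ne_zero h2).symm

/-- The projection to the eigenspace for `r` of the matrix `diagConj Q d`. -/
noncomputable def eigenProj (Q : (Matrix m m ℂ)ˣ) (d : m → ℚ) (r : ℚ) : Matrix m m ℂ :=
  diagConj Q ((fun z : ℂ => if z = r then 1 else 0) ∘ fun i => (d i : ℂ))

theorem eigenProj_mul_self (Q : (Matrix m m ℂ)ˣ) (d : m → ℚ) (r : ℚ) :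
    eigenProj Q d r * eigenProj Q d r = eigenProj Q d r := by
  rw [eigenProj, diagConj_mul]
  congr 1
  funext i
  simp

theorem commute_eigenProj {Q : (Matrix m m ℂ)ˣ} {d : m → ℚ} {M : Matrix m m ℂ}
    (hM : Commute M (diagConj Q fun i => (d i : ℂ))) (r : ℚ) : Commute M (eigenProj Q d r) :=
  mul_diagConj_comp hM _

/-- A finite set of rational numbers, symmetric about `0`, that contains the values of `d`. -/
def symmValues (d : m → ℚ) : Finset ℚ :=
  Finset.univ.image d ∪ Finset.univ.image (-d)

theorem sum_smul_eigenProj (Q : (Matrix m m ℂ)ˣ) (d : m → ℚ) :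
    ∑ r ∈ symmValues d, (r : ℂ) • eigenProj Q d r = diagConj Q fun i => (d i : ℂ) := by
  have hsum : ∀ (s : Finset ℚ) (f : ℚ → m → ℂ),
      ∑ r ∈ s, diagConj Q (f r) = diagConj Q (∑ r ∈ s, f r) := by
    intro s f
    induction s using Finset.induction_on with
    | empty => simp [diagConj_zero]
    | insert a s ha ih => rw [Finset.sum_insert ha, Finset.sum_insert ha, ih, diagConj_add]
  simp only [eigenProj, diagConj_smul]
  rw [hsum]
  congr 1
  funext i
  have hi : d i ∈ symmValues d :=
    Finset.mem_union_left _ (Finset.mem_image_of_mem _ (Finset.mem_univ i))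
  simp only [Finset.sum_apply, Pi.smul_apply, Function.comp_apply, smul_eq_mul, mul_ite, mul_one,
    mul_zero, Rat.cast_inj]
  rw [Finset.sum_ite_eq, if_pos hi]

/-- The logarithm of the absolute value of the character `∏ (det g|V_r) ^ r`, where `V_r` runs over
the eigenspaces of `diagConj Q d`. -/
noncomputable def logChar (Q : (Matrix m m ℂ)ˣ) (d : m → ℚ) (M : Matrix m m ℂ) : ℝ :=
  ∑ r ∈ symmValues d, r * Real.log ‖detOn (eigenProj Q d r) M‖

variable {Q : (Matrix m m ℂ)ˣ} {d : m → ℚ}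

theorem logChar_one : logChar Q d 1 = 0 := by
  simp [logChar, detOn_one]

theorem logChar_mul {g k : (Matrix m m ℂ)ˣ}
    (hg : Commute g.val (diagConj Q fun i => (d i : ℂ)))
    (hk : Commute k.val (diagConj Q fun i => (d i : ℂ))) :
    logChar Q d (g.val * k.val) = logChar Q d g.val + logChar Q d k.val := by
  rw [logChar, logChar, logChar, ← Finset.sum_add_distrib]
  refine Finset.sum_congr rfl fun r _ => ?_
  have hP := eigenProj_mul_self Q d r
  rw [detOn_mul hP (commute_eigenProj hk r), norm_mul, Real.log_mul, mul_add]
  · exact norm_ne_zero_iff.2 (detOn_ne_zero hP (commute_eigenProj hg r))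
  · exact norm_ne_zero_iff.2 (detOn_ne_zero hP (commute_eigenProj hk r))

/-- The eigenspace of `r` contributes `r · Re tr (A P_r)`, and `∑ r P_r` is the diagonalized matrix.
This ties the character to the trace form. -/
theorem logChar_exp {A : Matrix m m ℂ} (hA : Commute A (diagConj Q fun i => (d i : ℂ))) :
    logChar Q d (NormedSpace.exp A) = (A * diagConj Q fun i => (d i : ℂ)).trace.re := by
  rw [← sum_smul_eigenProj, Finset.mul_sum, trace_sum, Complex.re_sum, logChar]
  refine Finset.sum_congr rfl fun r _ => ?_
  rw [detOn_exp (eigenProj_mul_self Q d r) (commute_eigenProj hA r), Complex.norm_exp,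
    Real.log_exp, mul_smul_comm, trace_smul, smul_eq_mul, ← Complex.ofReal_ratCast,
    Complex.re_ofReal_mul]

/-- Since `w` carries `V_r` to `V_{-r}` and commutes with `M`, the two determinants agree and the
terms of `r` and `-r` cancel. -/
theorem logChar_eq_zero_of_semiconj {M : Matrix m m ℂ} {w : (Matrix m m ℂ)ˣ}
    (hw : w.val * (diagConj Q fun i => (d i : ℂ)) = -(diagConj Q fun i => (d i : ℂ)) * w.val)
    (hM : Commute w.val M) : logChar Q d M = 0 := by
  have hP : ∀ r, w.val * eigenProj Q d r = eigenProj Q d (-r) * w.val := by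
    intro r
    rw [diagConj_neg] at hw
    rw [eigenProj, mul_diagConj_comp hw, eigenProj]
    congr 2
    funext i
    simp only [Function.comp_apply, Pi.neg_apply, Rat.cast_neg, neg_eq_iff_eq_neg]
  have h1 : logChar Q d M = -logChar Q d M := by
    conv_lhs => rw [logChar]
    rw [logChar, ← Finset.sum_neg_distrib]
    have hsymm : ∀ r ∈ symmValues d, -r ∈ symmValues d := by
      intro r hr
      simp only [symmValues, Finset.mem_union, Finset.mem_image, Finset.mem_univ, true_and,
        Pi.neg_apply] at hr ⊢
      rcases hr with ⟨i, rfl⟩ | ⟨i, rfl⟩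
      · exact Or.inr ⟨i, rfl⟩
      · exact Or.inl ⟨i, (neg_neg _).symm⟩
    refine Finset.sum_nbij' (fun r => -r) (fun r => -r) hsymm hsymm (by simp) (by simp) ?_
    intro r _
    rw [detOn_eq_of_semiconj (hP r) hM]
    push_cast
    ring
  linarith

end Character

/-! ### The `𝔰𝔩₂`-relations -/

section Sl2

variable {m : Type*} [Fintype m] [DecidableEq m]

/-- In the presence of the `𝔰𝔩₂`-relations there is an invertible matrix, in the group generated
by `exp x` and `exp y`, that conjugates `h` to `-h`. -/
theorem exists_weyl_element {h x y : Matrix m m ℂ} (hx : h * x - x * h = x)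
    (hy : h * y - y * h = -y) (hxy : x * y - y * x = (2 : ℂ) • h) :
    ∃ w : (Matrix m m ℂ)ˣ, w.val * h = -h * w.val ∧
      ∀ M, Commute M x → Commute M y → Commute w.val M := by
  let w : (Matrix m m ℂ)ˣ := (Matrix.isUnit_exp x).unit * (Matrix.isUnit_exp (-y)).unit *
    (Matrix.isUnit_exp x).unit
  -- Under conjugation by the three factors, `h` moves to `h - x`, then to `-h - x`, then to `-h`.
  have hw : w.val = NormedSpace.exp x * NormedSpace.exp (-y) * NormedSpace.exp x := rfl
  have h1 : NormedSpace.exp x * h = (h - x) * NormedSpace.exp x := by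
    have := exp_conj_of_lie_lie_lie (X := x) (Z := h) (W := -x) (V := 0)
      (by rw [← neg_sub, hx]) (by simp) (by simp)
    rwa [smul_zero, add_zero, ← sub_eq_add_neg] at this
  have h2 : NormedSpace.exp (-y) * (h - x) = (-h - x) * NormedSpace.exp (-y) := by
    have := exp_conj_of_lie_lie_lie (X := -y) (Z := h - x) (W := -y - (2 : ℂ) • h)
      (V := (2 : ℂ) • y) ?_ ?_ (by simp)
    · rw [this, smul_smul, inv_mul_cancel₀ two_ne_zero, one_smul, two_smul]
      congr 1
      abel
    · rw [← hxy]
      have : -y * (h - x) - (h - x) * -y = (h * y - y * h) - (x * y - y * x) := by noncomm_ring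
      rw [this, hy]
    · have : -y * (-y - (2 : ℂ) • h) - (-y - (2 : ℂ) • h) * -y
          = -((2 : ℂ) • (h * y - y * h)) := by
        simp only [mul_sub, sub_mul, mul_smul_comm, smul_mul_assoc, neg_mul, mul_neg, smul_sub,
          smul_neg]
        abel
      rw [this, hy, smul_neg, neg_neg]
  have h3 : NormedSpace.exp x * (-h - x) = -h * NormedSpace.exp x := by
    have := exp_conj_of_lie_lie_lie (X := x) (Z := -h - x) (W := x) (V := 0)
      (by
        have : x * (-h - x) - (-h - x) * x = h * x - x * h := by noncomm_ring
        rw [this, hx]) (by simp) (by simp)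
    rwa [smul_zero, add_zero, sub_add_cancel] at this
  refine ⟨w, ?_, fun M hMx hMy => ?_⟩
  · rw [hw, mul_assoc, h1, ← mul_assoc, mul_assoc (NormedSpace.exp x), h2, ← mul_assoc, h3]
    simp only [mul_assoc]
  · have e1 : Commute M (NormedSpace.exp x) := semiconjBy_exp hMx
    have e2 : Commute M (NormedSpace.exp (-y)) := semiconjBy_exp hMy.neg_right
    rw [hw]
    exact ((e1.mul_right e2).mul_right e1).symm

/-- What centralizes `h` and `x` in an `𝔰𝔩₂`-triple centralizes `y`. -/
theorem commute_of_sl2 {h x y : Matrix m m ℂ} (h_ne : h ≠ 0) (hx : h * x - x * h = x)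
    (hy : h * y - y * h = -y) (hxy : x * y - y * x = (2 : ℂ) • h) {u : (Matrix m m ℂ)ˣ}
    (huh : Commute u.val h) (hux : Commute u.val x) : Commute u.val y := by
  have ht : IsSl2Triple ((2 : ℂ) • h) x y := by
    refine ⟨smul_ne_zero two_ne_zero h_ne, hxy, ?_, ?_⟩
    · rw [Ring.lie_def, smul_mul_assoc, mul_smul_comm, ← smul_sub, hx, two_smul, two_smul]
    · rw [Ring.lie_def, smul_mul_assoc, mul_smul_comm, ← smul_sub, hy, two_smul, two_smul, neg_add]
  have hconj : ∀ A B : Matrix m m ℂ, Commute u.val A →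
      A * (u.val * B * (u⁻¹).val) - u.val * B * (u⁻¹).val * A =
        u.val * (A * B - B * A) * (u⁻¹).val := by
    intro A B hA
    have hA' : Commute (u⁻¹).val A := hA.units_inv_left
    rw [mul_sub, sub_mul, ← mul_assoc, ← mul_assoc, ← mul_assoc, ← hA.eq]
    congr 1
    simp only [mul_assoc, hA'.eq]
  by_contra hne
  have hD : u.val * y * (u⁻¹).val - y ≠ 0 := by
    intro h0
    apply hne
    rw [sub_eq_zero] at h0
    change u.val * y = y * u.val
    conv_rhs => rw [← h0]
    rw [mul_assoc, Units.inv_mul, mul_one]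
  -- The difference `u y u⁻¹ - y` is killed by `ad x` and has weight `-2` for `2h`, but a nonzero
  -- vector killed by `ad x` has nonnegative weight in a finite-dimensional representation.
  have hP : ht.HasPrimitiveVectorWith (u.val * y * (u⁻¹).val - y) (-2 : ℂ) := by
    refine ⟨hD, ?_, ?_⟩
    · have h1 := hconj h y huh
      rw [hy] at h1
      rw [smul_lie, Ring.lie_def, mul_sub, sub_mul, sub_sub_sub_comm, h1, hy, neg_smul, ← smul_neg]
      congr 1
      noncomm_ring
    · have h1 := hconj x y hux
      have h2 : u.val * h * (u⁻¹).val = h := by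
        rw [huh.eq, mul_assoc, Units.mul_inv, mul_one]
      rw [hxy, mul_smul_comm, smul_mul_assoc, h2] at h1
      rw [Ring.lie_def, mul_sub, sub_mul, sub_sub_sub_comm, h1, hxy, sub_self]
  obtain ⟨k, hk⟩ := hP.exists_nat
  have h1 := congrArg Complex.re hk
  simp only [Complex.neg_re, Complex.re_ofNat, Complex.natCast_re] at h1
  have h2 : (0 : ℝ) ≤ k := Nat.cast_nonneg k
  linarith

end Sl2

/-! ### The character argument for distinct orbits -/

section Main

variable {n : ℕ} {𝔤 : LieSubalgebra ℂ (Matrix (Fin n) (Fin n) ℂ)}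

theorem logChar_eq_zero_of_mem_reducedThetaGroup {h : 𝔤} {Q : GL (Fin n) ℂ} {d : Fin n → ℚ}
    (hQ : h.val = diagConj Q fun i => (d i : ℂ)) {g : GL (Fin n) ℂ}
    (hg : g ∈ reducedThetaGroup h) : logChar Q d g.val = 0 := by
  have hcomm : ∀ g ∈ reducedThetaGroup h, Commute g.val (diagConj Q fun i => (d i : ℂ)) :=
    fun g hg => hQ ▸ (commute_of_mem_gradeZeroGroup (reducedThetaGroup_le h hg)).symm
  induction hg using Subgroup.closure_induction with
  | mem g hg =>
    obtain ⟨ξ, hξ, rfl⟩ := hg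
    have h1 := (mem_grade_zero_iff.1 hξ.1).symm
    rw [hQ] at h1
    rw [expGL_val, logChar_exp h1, ← hQ, trace_mul_comm, hξ.2, Complex.zero_re]
  | one => exact logChar_one
  | mul a b ha hb iha ihb =>
    rw [Units.val_mul, logChar_mul (hcomm a ha) (hcomm b hb), iha, ihb, add_zero]
  | inv a ha iha =>
    have h1 := logChar_mul (hcomm a ha) (hcomm a⁻¹ (inv_mem ha))
    rw [Units.mul_inv, logChar_one, iha, zero_add] at h1
    exact h1.symm

theorem adOrbit_ne_of_isDynkinCharacteristic {h x : 𝔤} {Q : GL (Fin n) ℂ} {d : Fin n → ℚ}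
    (h_ne : h.val ≠ 0) (hQ : h.val = diagConj Q fun i => (d i : ℂ)) (hx : x ∈ grade h 1)
    (hchar : IsDynkinCharacteristic h ((2 : ℂ) • h) x) :
    adOrbit (reducedThetaGroup h) x ≠ adOrbit (gradeZeroGroup h) x := by
  intro horb
  obtain ⟨-, y, hy, hxy, -, -⟩ := hchar
  have ex : h.val * x.val - x.val * h.val = x.val := by simpa using mem_grade_iff.1 hx
  have ey : h.val * y.val - y.val * h.val = -y.val := by simpa using mem_grade_iff.1 hy
  have exy : x.val * y.val - y.val * x.val = (2 : ℂ) • h.val := by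
    have := congrArg Subtype.val hxy
    rwa [LieSubalgebra.coe_bracket, Ring.lie_def] at this
  have hh : h ∈ grade h 0 := mem_grade_zero_iff.2 rfl
  have hmem : (expGL h.val).val * x.val * ((expGL h.val)⁻¹).val ∈
      adOrbit (gradeZeroGroup h) x := ⟨_, Subgroup.subset_closure ⟨h, hh, rfl⟩, rfl⟩
  rw [← horb] at hmem
  obtain ⟨g, hg, hgx⟩ := hmem
  have hgh : Commute g.val h.val :=
    (commute_of_mem_gradeZeroGroup (reducedThetaGroup_le h hg)).symm
  have heh : Commute (expGL h.val).val h.val := (commute_expGL rfl).symm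
  let u : GL (Fin n) ℂ := (expGL h.val)⁻¹ * g
  have huh : Commute u.val h.val := (heh.units_inv_left).mul_left hgh
  have hux : Commute u.val x.val := by
    have h1 : ((expGL h.val)⁻¹).val * ((expGL h.val).val * x.val * ((expGL h.val)⁻¹).val) * g.val =
        ((expGL h.val)⁻¹).val * (g.val * x.val * (g⁻¹).val) * g.val := by rw [hgx]
    simp only [mul_assoc, Units.inv_mul_cancel_left, Units.inv_mul, mul_one] at h1
    change ((expGL h.val)⁻¹).val * g.val * x.val = x.val * (((expGL h.val)⁻¹).val * g.val)
    rw [h1, mul_assoc]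
  have h_ne' : h.val ≠ 0 := h_ne
  have huy : Commute u.val y.val := commute_of_sl2 h_ne' ex ey exy huh hux
  obtain ⟨w, hw, hwc⟩ := exists_weyl_element ex ey exy
  have hu0 : logChar Q d u.val = 0 := by
    rw [hQ] at hw
    exact logChar_eq_zero_of_semiconj hw (hwc _ hux huy)
  have hg0 := logChar_eq_zero_of_mem_reducedThetaGroup hQ hg
  have hgu : g.val = (expGL h.val).val * u.val := by
    change _ = (expGL h.val).val * (((expGL h.val)⁻¹).val * g.val)
    rw [Units.mul_inv_cancel_left]
  -- Evaluating the character on `g = exp(h) u` gives `0 = (h, h) + 0`.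
  rw [hgu, logChar_mul (hQ ▸ heh) (hQ ▸ huh), hu0, add_zero, expGL_val,
    logChar_exp (hQ ▸ Commute.refl _), hQ, trace_sq_diagConj_rat, Complex.ratCast_re] at hg0
  exact (sum_mul_self_pos (hQ ▸ h_ne')).ne' (by exact_mod_cast hg0)

end Main

end ThetaGroup

open ThetaGroup in
/-- Let `G ⊆ GL n ℂ` be a reductive algebraic group with Lie algebra `𝔤`, and let
`0 ≠ h ∈ [𝔤, 𝔤]` define a `ℤ`-grading of `𝔤`. For `x ∈ 𝔤₁`, the orbits `G̃₀ x` and `G₀ x` differ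
if and only if `2h` is a Dynkin characteristic of `x`. -/
theorem theorem2p7 {n : ℕ} (G : LinearAlgebraicGroup n) (hG : G.IsReductive)
    (h : G.lieAlgebra) (hderived : h ∈ LieAlgebra.derivedSeries ℂ G.lieAlgebra 1) (h_ne : h ≠ 0)
    (hgrading : DefinesGrading h) (x : G.lieAlgebra) (hx : x ∈ grade h 1) :
    adOrbit (reducedThetaGroup h) x ≠ adOrbit (gradeZeroGroup h) x ↔
      IsDynkinCharacteristic h ((2 : ℂ) • h) x := by
  obtain ⟨Q, d, hQ⟩ := exists_eq_diagConj_rat hG hderived hgrading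
  have h_ne' : h.val ≠ 0 := fun h0 => h_ne (Subtype.ext h0)
  have htr : (h.val * h.val).trace ≠ 0 := by
    rw [hQ, trace_sq_diagConj_rat]
    exact_mod_cast (sum_mul_self_pos (hQ ▸ h_ne')).ne'
  exact ⟨isDynkinCharacteristic_of_adOrbit_ne hG htr hgrading hx,
    adOrbit_ne_of_isDynkinCharacteristic h_ne' hQ hx⟩
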